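/- Let $\Omega=[0,2\pi]^2$. Let $H$ be the space of real $2\pi$-periodic vector fields in $L^2(\Omega)^2$ that are mean-free and divergence-free in the sense of distributions, with norm $|u|^2=\int_\Omega|u|^2\,dx$, and let $V$ be the space of $u\in H$ with weak first derivatives in $L^2$, with norm $\|u\|^2=\sum_{j=1,2}\int_\Omega|\partial_ju|^2\,dx$. Let $\mathbb P$ be the Leray projection onto $H$, $A=-\mathbb P\Delta$ the Stokes operator with domain $D(A)$, $B(u,v)=\mathbb P((u\cdot\nabla)v)$, and, for $K>0$, let $P_K$ be the projection onto the Fourier wave vectors $k\in\mathbb Z^2$ with $|k|\le K$. Let $\nu>0$, $K>0$, and let $g_1,g_2\in L^\infty(0,\infty;H)$ form a synchronous pair, i.e. $|g_1(t)-g_2(t)|\to0$ as $t\to\infty$. Put $$\mathfrak g_j=\frac{\sup_{t\ge0}|g_j(t)|}{\nu^2}\quad(j=1,2),\qquad \mathfrak g=(\mathfrak g_1^2+\mathfrak g_2^2)^{1/2},$$ the suprema being essential suprema. For $\theta_1+\theta_2=1$, the symmetric direct-replacement intertwinement is the system $$\partial_tv_1+\nu Av_1+B(v_1,v_1)=g_1+\theta_1P_KB(v_1,v_1)-\theta_2P_KB(v_2,v_2),$$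 $$\partial_tv_2+\nu Av_2+B(v_2,v_2)=g_2-\theta_2P_KB(v_1,v_1)+\theta_1P_KB(v_2,v_2),$$ and a global solution of it is a pair $v=(v_1,v_2)$ with $v_1,v_2\in C([0,T];V)\cap L^2(0,T;D(A))$ for all $T>0$ that satisfies the system (in $H$, for almost every $t>0$), with arbitrary initial data $v(0)\in V\times V$. Write $\|v\|^2=\|v_1\|^2+\|v_2\|^2$. Theorem. There are absolute constants $C_0,C_1>0$ (independent of $\nu$, $K$, $g_1$, $g_2$ and $v$) such that, for all such $\nu,K,g_1,g_2$ and every global solution $v$ of the symmetric direct-replacement intertwinement with $\theta_1=1$ (hence $\theta_2=0$), if $$K\ge C_0\,(\ln(e+K))^{1/2}\,\mathfrak g,$$ then $$\limsup_{t\to\infty}\|v(t)\|\le C_1\,\nu\,\mathfrak g.$$ -/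

import Mathlib

open MeasureTheory Filter Topology
open scoped ENNReal ContDiff

noncomputable section

namespace Intertwinement

/-- The plane. -/
abbrev Plane : Type := EuclideanSpace ℝ (Fin 2)

/-- The period cell `[0, 2π]²`. -/
def cell : Set Plane := {x | ∀ i, x i ∈ Set.Icc (0 : ℝ) (2 * Real.pi)}

/-- Square-integrable real vector fields on the period cell, that is, `2π`-periodic `L²` fields.
Its inner product is `(u, v) = ∫ u · v` and its norm is `|u|`. -/
abbrev L2 : Type := Lp Plane 2 (volume.restrict cell)

/-- Smooth real functions on the plane, `2π`-periodic in each coordinate (test functions). -/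
structure IsTest (φ : Plane → ℝ) : Prop where
  smooth : ContDiff ℝ ∞ φ
  periodic : ∀ (i : Fin 2) (x : Plane), φ (x + EuclideanSpace.single i (2 * Real.pi)) = φ x

/-- The fields that are constant or the gradient of a test function. -/
def constOrGradient : Set L2 :=
  {w | (∃ c : Plane, ∀ᵐ x ∂(volume.restrict cell), w x = c) ∨
    ∃ φ : Plane → ℝ, IsTest φ ∧ ∀ᵐ x ∂(volume.restrict cell), w x = gradient φ x}

/-- The space `H` of periodic `L²` fields that are mean-free (orthogonal to the constants) and
divergence-free in the sense of distributions (orthogonal to all gradients of test functions). -/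
def H : Submodule ℝ L2 := (Submodule.span ℝ constOrGradient)ᗮ

instance : CompleteSpace H :=
  inferInstanceAs (CompleteSpace ((Submodule.span ℝ constOrGradient)ᗮ : Submodule ℝ L2))

/-- The Leray projection: the orthogonal projection of `L²` onto `H`. -/
def leray : L2 →L[ℝ] L2 := H.starProjection

/-- `f` is the weak (distributional) partial derivative `∂ⱼ u` of the periodic field `u`. -/
def IsWeakDeriv (j : Fin 2) (u f : L2) : Prop :=
  ∀ φ : Plane → ℝ, IsTest φ →
    ∫ x in cell, (fderiv ℝ φ x (EuclideanSpace.single j 1)) • u x = - ∫ x in cell, φ x • f x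

open Classical in
/-- The weak derivative `∂ⱼ u` (with the value `0` if there is none in `L²`). -/
def weakDeriv (j : Fin 2) (u : L2) : L2 :=
  if h : ∃ f, IsWeakDeriv j u f then h.choose else 0

/-- Membership in `V`: elements of `H` with weak first derivatives in `L²`. -/
def MemV (u : L2) : Prop := u ∈ H ∧ ∀ j, ∃ f, IsWeakDeriv j u f

/-- The norm `‖u‖` of `V`, with `‖u‖² = ∑ⱼ ∫ |∂ⱼ u|²`. -/
def normV (u : L2) : ℝ := √(∑ j, ‖weakDeriv j u‖ ^ 2)

/-- The Fourier coefficient `û_k = (2π)⁻² ∫ u(x) exp(-i k·x) dx`, a vector in `ℂ²`. -/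
def coeff (u : L2) (k : Fin 2 → ℤ) (j : Fin 2) : ℂ :=
  ((2 * Real.pi : ℝ) : ℂ)⁻¹ ^ 2 *
    ∫ x in cell, ((u x j : ℝ) : ℂ) * Complex.exp (-(Complex.I * ((∑ i, (k i : ℝ) * x i : ℝ) : ℂ)))

/-- The squared Euclidean length `|k|²` of a wave vector. -/
def waveSq (k : Fin 2 → ℤ) : ℝ := ∑ i, (k i : ℝ) ^ 2

/-- `f` is the field `∑ₖ m(k) û_k exp(i k·x)`. -/
def IsMultiplier (m : (Fin 2 → ℤ) → ℝ) (u f : L2) : Prop :=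
  ∀ k j, coeff f k j = (m k : ℂ) * coeff u k j

open Classical in
/-- The Fourier multiplier `u ↦ ∑ₖ m(k) û_k exp(i k·x)` (with the value `0` if the series is not
the Fourier series of a field in `L²`). -/
def multiplier (m : (Fin 2 → ℤ) → ℝ) (u : L2) : L2 :=
  if h : ∃ f, IsMultiplier m u f then h.choose else 0

/-- Membership in the domain `D(A)` of the Stokes operator. -/
def MemDA (u : L2) : Prop := u ∈ H ∧ ∃ f, IsMultiplier waveSq u f

/-- The Stokes operator `A u = ∑ₖ |k|² û_k exp(i k·x)`. -/
def stokes (u : L2) : L2 := multiplier waveSq u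

open Classical in
/-- The projection `P_K` onto the Fourier wave vectors with `|k| ≤ K`. -/
def lowModes (K : ℝ) (u : L2) : L2 := multiplier (fun k => if √(waveSq k) ≤ K then 1 else 0) u

/-- The field `(u · ∇) v = ∑ᵢ uᵢ ∂ᵢ v`. -/
def advection (u v : L2) (x : Plane) : Plane := ∑ i, (u x i) • weakDeriv i v x

open Classical in
/-- The bilinear form `B(u, v) = ℙ((u · ∇) v)`. It is only used where `(u · ∇) v` lies in `L²`, in
particular for `u` in `D(A)` and `v` in `V`; it has the value `0` elsewhere. -/
def B (u v : L2) : L2 :=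
  if h : MemLp (advection u v) 2 (volume.restrict cell) then leray (h.toLp (advection u v)) else 0

/-- Membership in `L^∞(0, ∞; H)`. -/
def MemLinftyH (f : ℝ → L2) : Prop :=
  MemLp f ∞ (volume.restrict (Set.Ioi 0)) ∧ ∀ᵐ t ∂(volume.restrict (Set.Ioi (0 : ℝ))), f t ∈ H

/-- Membership in `C([0, T]; V) ∩ L²(0, T; D(A))` for every `T > 0`. -/
structure IsStrongPath (u : ℝ → L2) : Prop where
  memV : ∀ t, 0 ≤ t → MemV (u t)
  continuous : ContinuousOn u (Set.Ici 0)
  continuous_deriv : ∀ j, ContinuousOn (fun t => weakDeriv j (u t)) (Set.Ici 0)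
  memDA : ∀ᵐ t ∂(volume.restrict (Set.Ioi (0 : ℝ))), MemDA (u t)
  stokes_memLp : ∀ T, 0 < T → MemLp (fun t => stokes (u t)) 2 (volume.restrict (Set.Ioc 0 T))

/-- The value of `dvᵢ/dt` prescribed by the intertwinement with intertwining matrix `M` and
intertwining function `F(u) = P_K B(u, u)`, namely
`gᵢ - ν A vᵢ - B(vᵢ, vᵢ) + ∑ⱼ mᵢⱼ P_K B(vⱼ, vⱼ)`. -/
def velocity (ν K : ℝ) (M : Matrix (Fin 2) (Fin 2) ℝ) (g v : Fin 2 → ℝ → L2) (i : Fin 2)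
    (t : ℝ) : L2 :=
  g i t - ν • stokes (v i t) - B (v i t) (v i t)
    + ∑ j, M i j • lowModes K (B (v j t) (v j t))

/-- `v = (v₁, v₂)` is a global solution of the direct-replacement system with matrix `M`,
`∂ₜvᵢ + ν A vᵢ + B(vᵢ, vᵢ) = gᵢ + ∑ⱼ mᵢⱼ P_K B(vⱼ, vⱼ)`, the equation being read in `H` for almost
every time, in integrated form; the initial value `v(0)` is any element of `V × V`. -/
structure IsSolution (ν K : ℝ) (M : Matrix (Fin 2) (Fin 2) ℝ) (g v : Fin 2 → ℝ → L2) :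
    Prop where
  strong : ∀ i, IsStrongPath (v i)
  integrable : ∀ i t, 0 ≤ t → IntervalIntegrable (velocity ν K M g v i) volume 0 t
  equation : ∀ i t, 0 ≤ t → v i t = v i 0 + ∫ s in (0 : ℝ)..t, velocity ν K M g v i s

/-- The intertwining matrix of the symmetric class (with `θ₁ + θ₂ = 1`). -/
def symMatrix (θ₁ θ₂ : ℝ) : Matrix (Fin 2) (Fin 2) ℝ := !![θ₁, -θ₂; -θ₂, θ₁]

/-- `(f₁, f₂)` is a synchronous pair: `|f₁(t) - f₂(t)| → 0` as `t → ∞` (outside a null set of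
times, as befits elements of `L^∞(0, ∞; H)`). -/
def Synchronous (f : Fin 2 → ℝ → L2) : Prop :=
  Tendsto (fun t => ‖f 0 t - f 1 t‖) (atTop ⊓ ae volume) (𝓝 0)

/-- `𝔤ⱼ = sup_{t ≥ 0} |gⱼ(t)| / ν²`, the supremum being the essential one. -/
def grashof (ν : ℝ) (f : ℝ → L2) : ℝ :=
  (eLpNorm f ∞ (volume.restrict (Set.Ioi 0))).toReal / ν ^ 2

/-- `𝔤 = (𝔤₁² + 𝔤₂²)^{1/2}`. -/
def totalGrashof (ν : ℝ) (g : Fin 2 → ℝ → L2) : ℝ := √(∑ j, grashof ν (g j) ^ 2)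

/-- `‖v‖ = (‖v₁‖² + ‖v₂‖²)^{1/2}` at time `t`. -/
def pairNormV (v : Fin 2 → ℝ → L2) (t : ℝ) : ℝ := √(∑ j, normV (v j t) ^ 2)

end Intertwinement

end

/-! For `θ₁ = 1`, `θ₂ = 0` the two equations decouple. Each component `u` solves the Navier–Stokes
equation with `P_K B(u,u)` removed, so it suffices to bound a single `u`. Write `u = p + q` with `p
= P_K u`. The low part solves the linear Stokes equation `∂ₜp + νAp = P_K g`, hence `‖p‖` eventually
drops below any `r` with `νr > sup |g|` (`inner_low_drift_le`).

The high part feels the nonlinearity. In its enstrophy balance the term `(B(u,u), Aq)` splits into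
the contributions of `(p,p)`, `(p,q)`, `(q,p)` and `(q,q)`. The last one vanishes by the
two-dimensional orthogonality `(B(q,q), Aq) = 0` (`IsRegular.trilinear_eq_zero`). The others contain
at least one factor `p`, already controlled by `r`. They are estimated with `|p|_∞ ≤ C
(ln(e+K))^{1/2} ‖p‖`, `|q|_∞ ≤ C K⁻¹ |Aq|` and `‖q‖ ≤ K⁻¹ |Aq|` (`ae_norm_le_low`,
`ae_norm_le_high`, `mul_enstrophy_high_le`). The result, `abs_trilinear_high_le`, has a part
quadratic in `|Aq|` with coefficient of order `(ln(e+K))^{1/2} r / K`, which the hypothesis on `K`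
makes a small multiple of `ν`, and a part linear in `|Aq|`, of size `ν K r |Aq|`. Both are absorbed
by the viscosity with the help of `|Aq|² ≥ K² ‖q‖²` (`inner_high_drift_le`), and Grönwall's lemma
bounds `‖q‖` eventually by a multiple of `r`.

All function spaces are handled through Fourier coefficients: Parseval (`hasSum_norm_sq`), the
description of `H` by `û_0 = 0` and `k·û_k = 0`, and weak derivatives as multiplication by `i k_j`.
The sup-norm bounds are Cauchy–Schwarz on the coefficients combined with lattice sums. The enstrophy
identity for strong solutions (`enstrophy_sub_eq_integral`) comes from truncating `A` to a bounded
operator and removing the truncation. -/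

noncomputable section

namespace Intertwinement

open scoped ComplexConjugate

/-! ### Characters and completeness of the Fourier system on the period cell -/

/-- Lebesgue measure on the period cell. -/
abbrev cellMeasure : Measure Plane := volume.restrict cell

/-- The character `x ↦ exp(i k·x)`. -/
def wave (k : Fin 2 → ℤ) (x : Plane) : ℂ :=
  Complex.exp (Complex.I * ((∑ i, (k i : ℝ) * x i : ℝ) : ℂ))

lemma continuous_wave (k : Fin 2 → ℤ) : Continuous (wave k) := by
  unfold wave; fun_prop

lemma norm_wave (k : Fin 2 → ℤ) (x : Plane) : ‖wave k x‖ = 1 := by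
  rw [wave, mul_comm, Complex.norm_exp_ofReal_mul_I]

lemma wave_add (k l : Fin 2 → ℤ) (x : Plane) : wave (k + l) x = wave k x * wave l x := by
  simp only [wave, ← Complex.exp_add, Pi.add_apply]
  congr 1; push_cast [Fin.sum_univ_two]; ring

lemma conj_wave (k : Fin 2 → ℤ) (x : Plane) : conj (wave k x) = wave (-k) x := by
  simp only [wave, ← Complex.exp_conj, map_mul, Complex.conj_I, Complex.conj_ofReal, Pi.neg_apply]
  congr 1; push_cast [Fin.sum_univ_two]; ring

section Torus

/-- The circle carries its Haar probability measure. -/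
local instance : MeasureSpace UnitAddCircle := ⟨AddCircle.haarAddCircle⟩

local instance : IsProbabilityMeasure (volume : Measure UnitAddCircle) :=
  inferInstanceAs (IsProbabilityMeasure AddCircle.haarAddCircle)

/-- The section of the torus with values in the period cell. -/
def torusSection (y : UnitAddTorus (Fin 2)) : Plane :=
  (2 * Real.pi) • WithLp.toLp 2 (UnitAddTorus.measurableEquivPiIoc (0 : Fin 2 → ℝ) y).1

lemma wave_torusSection (k : Fin 2 → ℤ) (y : UnitAddTorus (Fin 2)) :
    wave k (torusSection y) = UnitAddTorus.mFourier k y := by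
  obtain ⟨x, rfl⟩ := (UnitAddTorus.measurableEquivPiIoc (0 : Fin 2 → ℝ)).symm.surjective y
  rw [torusSection, MeasurableEquiv.apply_symm_apply]
  simp only [UnitAddTorus.coe_symm_measurableEquivPiIoc_apply, UnitAddTorus.mFourier, ContinuousMap.coe_mk,
    wave, Fin.prod_univ_two, Fin.sum_univ_two, fourier_coe_apply, ← Complex.exp_add]
  congr 1
  simp only [PiLp.smul_apply, smul_eq_mul]
  push_cast
  ring

/-- The dilated half-open unit cell misses only faces of the closed square, which are null. -/
lemma cell_ae_eq : (cell : Set Plane) =ᵐ[volume]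
    (fun x => (2 * Real.pi) • WithLp.toLp 2 x : (Fin 2 → ℝ) → Plane) ''
      {x | ∀ i, x i ∈ Set.Ioc ((0 : Fin 2 → ℝ) i) ((0 : Fin 2 → ℝ) i + 1)} := by
  have h2 : 0 < 2 * Real.pi := by positivity
  have : (fun x => (2 * Real.pi) • WithLp.toLp 2 x : (Fin 2 → ℝ) → Plane) ''
      {x | ∀ i, x i ∈ Set.Ioc ((0 : Fin 2 → ℝ) i) ((0 : Fin 2 → ℝ) i + 1)} =
      WithLp.ofLp ⁻¹' Set.pi Set.univ (fun _ : Fin 2 => Set.Ioc 0 (2 * Real.pi)) := by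
    ext x
    simp only [Set.mem_image, Set.mem_ofPred_eq, Set.mem_preimage, Set.mem_pi, Set.mem_univ,
      true_implies, Pi.zero_apply, zero_add]
    constructor
    · rintro ⟨y, hy, rfl⟩ i
      have := hy i
      simp only [PiLp.smul_apply, smul_eq_mul, Set.mem_Ioc] at this ⊢
      constructor <;> nlinarith
    · intro h
      refine ⟨fun i => (2 * Real.pi)⁻¹ * x i, fun i => ?_, ?_⟩
      · have := h i
        simp only [Set.mem_Ioc] at this ⊢
        rw [inv_mul_eq_div]
        exact ⟨div_pos this.1 h2, (div_le_one h2).2 this.2⟩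
      · ext i
        simp
        field_simp
  rw [this]
  have hc : cell = WithLp.ofLp ⁻¹' Set.pi Set.univ (fun _ : Fin 2 => Set.Icc 0 (2 * Real.pi)) := by
    ext x; simp only [cell, Set.mem_preimage, Set.mem_pi, Set.mem_univ, true_implies]; rfl
  rw [hc]
  refine (PiLp.volume_preserving_ofLp (Fin 2)).quasiMeasurePreserving.preimage_ae_eq ?_
  have := Measure.univ_pi_Ioc_ae_eq_Icc (μ := fun _ : Fin 2 => (volume : Measure ℝ))
    (f := fun _ => 0) (g := fun _ => 2 * Real.pi)
  rw [← Set.pi_univ_Icc] at this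
  exact this.symm

/-- Haar measure on the torus is Lebesgue measure on the half-open unit cell, and the dilation by
`2π` multiplies plane measure by `(2π)²`; the scalar restores total mass one. This transfers
completeness of the characters from the torus to `cell`. -/
lemma measurePreserving_torusSection :
    MeasurePreserving torusSection volume
      (ENNReal.ofReal (((2 * Real.pi) ^ 2)⁻¹) • cellMeasure) := by
  have h2 : 0 < 2 * Real.pi := by positivity
  set S : Set (Fin 2 → ℝ) := {x | ∀ i, x i ∈ Set.Ioc ((0 : Fin 2 → ℝ) i) ((0 : Fin 2 → ℝ) i + 1)}
  have hS : MeasurableSet S := by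
    have : S = Set.pi Set.univ (fun i => Set.Ioc ((0 : Fin 2 → ℝ) i) ((0 : Fin 2 → ℝ) i + 1)) := by
      ext; simp [S]
    rw [this]
    exact MeasurableSet.univ_pi fun i => measurableSet_Ioc
  have h1 := UnitAddTorus.measurePreserving_equivPiIoc (0 : Fin 2 → ℝ)
  have h3 := measurePreserving_subtype_coe (μa := (volume : Measure (Fin 2 → ℝ))) hS
  have h4 : MeasurePreserving (fun x => (2 * Real.pi) • WithLp.toLp 2 x : (Fin 2 → ℝ) → Plane)
      volume (ENNReal.ofReal (((2 * Real.pi) ^ 2)⁻¹) • volume) := by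
    refine MeasurePreserving.comp (g := fun x : Plane => (2 * Real.pi) • x) (μb := volume) ?_
      (PiLp.volume_preserving_toLp (Fin 2))
    refine ⟨measurable_const_smul _, ?_⟩
    rw [Measure.map_addHaar_smul _ h2.ne']
    simp [abs_of_pos, h2]
  have he : MeasurableEmbedding
      (fun x => (2 * Real.pi) • WithLp.toLp 2 x : (Fin 2 → ℝ) → Plane) :=
    ((MeasurableEquiv.smul₀ (2 * Real.pi) h2.ne').measurableEmbedding).comp
      (MeasurableEquiv.toLp 2 (Fin 2 → ℝ)).measurableEmbedding
  have h5 := h4.restrict_image_emb he S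
  have h6 := (h5.comp h3).comp h1
  convert! h6 using 1
  rw [Measure.restrict_smul, cellMeasure, Measure.restrict_congr_set cell_ae_eq]

lemma ae_eq_zero_of_torusSection {f : Plane → ℂ} (hf : StronglyMeasurable f)
    (h : ∀ᵐ y : UnitAddTorus (Fin 2), f (torusSection y) = 0) : ∀ᵐ x ∂cellMeasure, f x = 0 := by
  have hm := measurePreserving_torusSection
  have := (ae_map_iff hm.measurable.aemeasurable
    (hf.measurable (measurableSet_singleton 0))).2 h
  change ∀ᵐ x ∂(Measure.map torusSection volume), f x = 0 at this
  rw [hm.map_eq] at this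
  rw [Measure.ae_ennreal_smul_measure_iff] at this
  · exact this
  · simp

lemma integral_torusSection {f : Plane → ℂ} (hf : AEStronglyMeasurable f cellMeasure) :
    ∫ x in cell, f x = ((2 * Real.pi) ^ 2 : ℝ) * ∫ y : UnitAddTorus (Fin 2), f (torusSection y) := by
  have hm := measurePreserving_torusSection
  have := integral_map (μ := volume) hm.measurable.aemeasurable
    (f := f) (by rw [hm.map_eq]; exact hf.smul_measure _)
  rw [← this, hm.map_eq, integral_smul_measure, ENNReal.toReal_ofReal (by positivity),
    Complex.real_smul, ← mul_assoc, ← Complex.ofReal_mul, mul_inv_cancel₀ (by positivity)]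
  simp

lemma integral_wave (k : Fin 2 → ℤ) :
    ∫ x in cell, wave k x = if k = 0 then ((2 * Real.pi) ^ 2 : ℂ) else 0 := by
  rw [integral_torusSection (continuous_wave k).aestronglyMeasurable]
  simp only [wave_torusSection]
  have := (orthonormal_iff_ite.1 (UnitAddTorus.orthonormal_mFourier (d := Fin 2))) 0 k
  rw [ContinuousMap.inner_toLp] at this
  simp only [UnitAddTorus.mFourier_zero, ContinuousMap.one_apply, map_one, mul_one,
    eq_comm (a := (0 : Fin 2 → ℤ))] at this
  rw [this]
  split_ifs <;> simp

/-- If all the Fourier coefficients of a square-integrable function vanish, so does it. -/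
lemma ae_eq_zero_of_forall_integral_eq_zero {f : Plane → ℂ} (hf : StronglyMeasurable f)
    (hf2 : MemLp f 2 cellMeasure) (h : ∀ k, ∫ x in cell, conj (wave k x) * f x = 0) :
    ∀ᵐ x ∂cellMeasure, f x = 0 := by
  have hm := measurePreserving_torusSection
  have hg : MemLp (fun y => f (torusSection y)) 2 (volume : Measure (UnitAddTorus (Fin 2))) := by
    refine MemLp.comp_measurePreserving ?_ hm
    exact hf2.smul_measure (by simp)
  refine ae_eq_zero_of_torusSection hf ?_
  have h0 : hg.toLp = 0 := by
    apply (UnitAddTorus.mFourierBasis (d := Fin 2)).repr.injective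
    ext k
    rw [map_zero, HilbertBasis.repr_apply_apply, UnitAddTorus.coe_mFourierBasis, L2.inner_def]
    have h1 := h k
    rw [integral_torusSection] at h1
    · simp only [wave_torusSection, mul_eq_zero] at h1
      rcases h1 with h1 | h1
      · simp [Real.pi_ne_zero] at h1
      · refine Eq.trans ?_ h1
        refine integral_congr_ae ?_
        filter_upwards [hg.coeFn_toLp, UnitAddTorus.coeFn_mFourierLp 2 k] with y h1 h2
        rw [h1, h2, RCLike.inner_apply, mul_comm]
    · exact (((continuous_wave k).star).aestronglyMeasurable).mul hf.aestronglyMeasurable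
  filter_upwards [hg.coeFn_toLp, Lp.coeFn_zero ℂ 2 (volume : Measure (UnitAddTorus (Fin 2)))]
    with y h1 h2
  rw [← h1, h0, h2]; rfl

/-- A positive multiple of this measure is the image of a probability measure. -/
instance : IsFiniteMeasure cellMeasure := by
  have h := measurePreserving_torusSection.measure_preimage MeasurableSet.univ.nullMeasurableSet
  rw [Set.preimage_univ, measure_univ, Measure.smul_apply, smul_eq_mul] at h
  refine ⟨lt_top_iff_ne_top.2 fun ht => ?_⟩
  rw [ht, ENNReal.mul_top (by simp)] at h
  exact ENNReal.one_ne_top h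

end Torus

/-- Square-integrable complex functions on the period cell. -/
abbrev ScalarL2 : Type := Lp ℂ 2 cellMeasure

lemma memLp_wave (k : Fin 2 → ℤ) : MemLp (wave k) 2 cellMeasure :=
  MemLp.of_bound (continuous_wave k).aestronglyMeasurable 1 (by simp [norm_wave])

/-- The normalized character `(2π)⁻¹ exp(i k·x)` as an element of `L²`. -/
def waveLp (k : Fin 2 → ℤ) : ScalarL2 := ((2 * Real.pi : ℝ) : ℂ)⁻¹ • (memLp_wave k).toLp (wave k)

lemma coeFn_waveLp (k : Fin 2 → ℤ) :
    waveLp k =ᵐ[cellMeasure] fun x => ((2 * Real.pi : ℝ) : ℂ)⁻¹ * wave k x := by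
  filter_upwards [Lp.coeFn_smul (((2 * Real.pi : ℝ) : ℂ)⁻¹) ((memLp_wave k).toLp (wave k)),
    (memLp_wave k).coeFn_toLp] with x h1 h2
  rw [waveLp, h1, Pi.smul_apply, h2, smul_eq_mul]

lemma inner_waveLp (k : Fin 2 → ℤ) (F : ScalarL2) :
    inner ℂ (waveLp k) F = ((2 * Real.pi : ℝ) : ℂ)⁻¹ * ∫ x in cell, wave (-k) x * F x := by
  rw [L2.inner_def, ← integral_const_mul]
  refine integral_congr_ae ?_
  filter_upwards [coeFn_waveLp k] with x hx
  rw [hx, RCLike.inner_apply, map_mul, map_inv₀, Complex.conj_ofReal, conj_wave]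
  ring

lemma orthonormal_waveLp : Orthonormal ℂ waveLp := by
  rw [orthonormal_iff_ite]
  intro k l
  rw [inner_waveLp]
  have : ∫ x in cell, wave (-k) x * waveLp l x =
      ∫ x in cell, ((2 * Real.pi : ℝ) : ℂ)⁻¹ * wave (-k + l) x := by
    refine integral_congr_ae ?_
    filter_upwards [coeFn_waveLp l] with x hx
    rw [hx, wave_add]; ring
  rw [this, integral_const_mul, integral_wave]
  have hpi : (Real.pi : ℂ) ≠ 0 := by exact_mod_cast Real.pi_ne_zero
  simp only [neg_add_eq_zero]
  split_ifs
  · push_cast; field_simp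
  · simp

/-- The Hilbert basis of normalized characters. -/
def fourierBasis : HilbertBasis (Fin 2 → ℤ) ℂ ScalarL2 :=
  HilbertBasis.mkOfOrthogonalEqBot orthonormal_waveLp <| by
    rw [Submodule.eq_bot_iff]
    intro F hF
    rw [Submodule.mem_orthogonal] at hF
    have h := ae_eq_zero_of_forall_integral_eq_zero (Lp.stronglyMeasurable F) (Lp.memLp F) ?_
    · rw [Lp.eq_zero_iff_ae_eq_zero]
      exact h
    · intro k
      have := hF (waveLp k) (Submodule.subset_span ⟨k, rfl⟩)
      rw [inner_waveLp, mul_eq_zero] at this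
      simp only [conj_wave]
      refine this.resolve_left ?_
      simp [Real.pi_ne_zero]

lemma fourierBasis_repr (F : ScalarL2) (k : Fin 2 → ℤ) :
    fourierBasis.repr F k = ((2 * Real.pi : ℝ) : ℂ)⁻¹ * ∫ x in cell, wave (-k) x * F x := by
  rw [HilbertBasis.repr_apply_apply, ← inner_waveLp]
  congr 1
  simp [fourierBasis]

/-! ### Fourier coefficients of real vector fields and Parseval's identity -/

/-- The `j`-th component of a real field, as a complex function. -/
def component (j : Fin 2) : L2 →L[ℝ] ScalarL2 :=
  (Complex.ofRealCLM.comp (EuclideanSpace.proj j : Plane →L[ℝ] ℝ)).compLpL 2 cellMeasure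

lemma coeFn_component (j : Fin 2) (u : L2) :
    component j u =ᵐ[cellMeasure] fun x => ((u x j : ℝ) : ℂ) := by
  filter_upwards [ContinuousLinearMap.coeFn_compLpL (p := 2) (μ := cellMeasure)
    (Complex.ofRealCLM.comp (EuclideanSpace.proj j : Plane →L[ℝ] ℝ)) u] with x hx
  rw [component, hx]; rfl

lemma coeff_eq_repr (u : L2) (k : Fin 2 → ℤ) (j : Fin 2) :
    coeff u k j = ((2 * Real.pi : ℝ) : ℂ)⁻¹ * fourierBasis.repr (component j u) k := by
  rw [fourierBasis_repr, ← mul_assoc, ← sq, coeff]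
  congr 1
  refine integral_congr_ae ?_
  filter_upwards [coeFn_component j u] with x hx
  rw [hx, ← conj_wave, mul_comm, wave, ← Complex.exp_conj]
  simp

lemma coeff_add (u v : L2) (k : Fin 2 → ℤ) (j : Fin 2) :
    coeff (u + v) k j = coeff u k j + coeff v k j := by
  simp only [coeff_eq_repr, map_add, ← mul_add]; rfl

lemma coeff_sub (u v : L2) (k : Fin 2 → ℤ) (j : Fin 2) :
    coeff (u - v) k j = coeff u k j - coeff v k j := by
  simp only [coeff_eq_repr, map_sub, ← mul_sub]; rfl

lemma coeff_smul (c : ℝ) (u : L2) (k : Fin 2 → ℤ) (j : Fin 2) :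
    coeff (c • u) k j = c * coeff u k j := by
  have h : component j (c • u) = (c : ℂ) • component j u := by
    rw [map_smul]; exact (Complex.coe_smul c _).symm
  rw [coeff_eq_repr, coeff_eq_repr, h, map_smul, lp.coeFn_smul, Pi.smul_apply, smul_eq_mul,
    mul_left_comm]

lemma coeff_neg (u : L2) (k : Fin 2 → ℤ) (j : Fin 2) :
    coeff u (-k) j = conj (coeff u k j) := by
  simp only [coeff, map_mul, ← integral_conj, map_pow, map_inv₀, Complex.conj_ofReal,
    ← Complex.exp_conj, map_neg, Complex.conj_I, Pi.neg_apply]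
  congr 3; ext x; congr 2; push_cast [Fin.sum_univ_two]; ring

lemma ofReal_inner_eq (u v : L2) :
    ((inner ℝ u v : ℝ) : ℂ) = ∑ j, inner ℂ (component j u) (component j v) := by
  simp only [L2.inner_def]
  rw [← integral_finsetSum]
  · rw [← integral_complex_ofReal]
    refine integral_congr_ae ?_
    filter_upwards [coeFn_component 0 u, coeFn_component 1 u, coeFn_component 0 v,
      coeFn_component 1 v] with x h1 h2 h3 h4
    simp [Fin.sum_univ_two, h1, h2, h3, h4, PiLp.inner_apply]
  · intro j _
    exact L2.integrable_inner _ _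

/-- Parseval in each component. The factor `(2π)²` arises because `coeff` is `(2π)⁻¹` times the
coefficient in the orthonormal basis. -/
lemma hasSum_inner (u v : L2) :
    HasSum (fun k => (2 * Real.pi) ^ 2 * ∑ j, (conj (coeff u k j) * coeff v k j).re)
      (inner ℝ u v) := by
  have h : HasSum (fun k => ∑ j, (conj (fourierBasis.repr (component j u) k) *
      fourierBasis.repr (component j v) k)) (((inner ℝ u v : ℝ) : ℂ)) := by
    rw [ofReal_inner_eq]
    refine hasSum_sum fun j _ => ?_
    simpa [HilbertBasis.repr_apply_apply] using
      fourierBasis.hasSum_inner_mul_inner (component j u) (component j v)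
  have h2 := Complex.hasSum_re h
  rw [Complex.ofReal_re] at h2
  convert! h2 using 2 with k
  rw [Complex.re_sum, Finset.mul_sum]
  refine Finset.sum_congr rfl fun j _ => ?_
  rw [coeff_eq_repr, coeff_eq_repr, map_mul, map_inv₀, Complex.conj_ofReal,
    show ∀ a b c : ℂ, a * b * (a * c) = a ^ 2 * (b * c) by intros; ring, ← Complex.ofReal_inv,
    ← Complex.ofReal_pow, Complex.re_ofReal_mul, ← mul_assoc, ← mul_pow, mul_inv_cancel₀ (by positivity),
    one_pow, one_mul]

lemma hasSum_norm_sq (u : L2) :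
    HasSum (fun k => (2 * Real.pi) ^ 2 * ∑ j, ‖coeff u k j‖ ^ 2) (‖u‖ ^ 2) := by
  have := hasSum_inner u u
  rw [real_inner_self_eq_norm_sq] at this
  convert! this using 4 with k j
  rw [← Complex.normSq_eq_conj_mul_self, Complex.ofReal_re, Complex.normSq_eq_norm_sq]

lemma ext_coeff {u v : L2} (h : ∀ k j, coeff u k j = coeff v k j) : u = v := by
  have h1 := hasSum_norm_sq (u - v)
  simp only [coeff_sub, h, sub_self, norm_zero] at h1
  have : ‖u - v‖ ^ 2 = 0 := h1.unique (by simp [hasSum_zero])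
  rwa [sq_eq_zero_iff, norm_eq_zero, sub_eq_zero] at this

/-- The real part of a scalar function, as the `j`-th component of a field. -/
def realField (j : Fin 2) : ScalarL2 →L[ℝ] L2 :=
  (Complex.reCLM.smulRight (EuclideanSpace.single j (1 : ℝ))).compLpL 2 cellMeasure

/-- From `Re F = (F + conj F)/2`, where conjugation reflects `k` to `-k`. For Hermitian coefficients
taking the real part therefore loses nothing, which is how `exists_coeff_eq` produces real fields.
-/
lemma coeff_realField (i j : Fin 2) (F : ScalarL2) (k : Fin 2 → ℤ) :
    coeff (realField i F) k j = if j = i then ((2 * Real.pi : ℝ) : ℂ)⁻¹ *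
      ((fourierBasis.repr F k + conj (fourierBasis.repr F (-k))) / 2) else 0 := by
  have hF : realField i F =ᵐ[cellMeasure] fun x => (F x).re • EuclideanSpace.single i (1 : ℝ) :=
    ContinuousLinearMap.coeFn_compLpL (p := 2) (μ := cellMeasure) _ F
  have hc : coeff (realField i F) k j = ((2 * Real.pi : ℝ) : ℂ)⁻¹ ^ 2 *
      ∫ x in cell, wave (-k) x * (((if j = i then (F x).re else 0 : ℝ)) : ℂ) := by
    rw [coeff]
    congr 1
    refine integral_congr_ae ?_
    filter_upwards [hF] with x hx
    rw [hx, ← conj_wave, mul_comm, wave, ← Complex.exp_conj]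
    simp
  rw [hc]
  split_ifs with h
  · have hi : ∀ l, Integrable (fun x => wave l x * F x) cellMeasure := fun l =>
      (memLp_wave l).integrable_mul (Lp.memLp F)
    have h1 : ∫ x in cell, wave (-k) x * (((F x).re : ℝ) : ℂ) =
        ((∫ x in cell, wave (-k) x * F x) + conj (∫ x in cell, wave k x * F x)) / 2 := by
      rw [← integral_conj, ← integral_add (hi _), ← integral_div]
      · congr 1; ext x
        rw [map_mul, conj_wave, Complex.re_eq_add_conj]; ring
      · exact Complex.conjCLE.toContinuousLinearMap.integrable_comp (hi k)
    rw [h1, fourierBasis_repr, fourierBasis_repr, map_mul, map_inv₀, Complex.conj_ofReal, neg_neg]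
    ring
  · simp

/-- Every square-summable Hermitian family is the family of Fourier coefficients of a field. -/
lemma exists_coeff_eq {c : (Fin 2 → ℤ) → Fin 2 → ℂ} (hc : ∀ k j, c (-k) j = conj (c k j))
    (hs : ∀ j, Summable fun k => ‖c k j‖ ^ 2) : ∃ f : L2, ∀ k j, coeff f k j = c k j := by
  have hm : ∀ j, Memℓp (fun k => ((2 * Real.pi : ℝ) : ℂ) * c k j) 2 := by
    intro j
    rw [memℓp_gen_iff (by norm_num)]
    simp only [norm_mul, ENNReal.toReal_ofNat, Real.rpow_ofNat, mul_pow]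
    exact (hs j).mul_left _
  let F : Fin 2 → ScalarL2 := fun j => fourierBasis.repr.symm ⟨_, hm j⟩
  refine ⟨realField 0 (F 0) + realField 1 (F 1), fun k j => ?_⟩
  have hF : ∀ j k, fourierBasis.repr (F j) k = ((2 * Real.pi : ℝ) : ℂ) * c k j := by
    intro j k; simp only [F, LinearIsometryEquiv.apply_symm_apply]
  have key : ((2 * Real.pi : ℝ) : ℂ)⁻¹ * ((fourierBasis.repr (F j) k +
      conj (fourierBasis.repr (F j) (-k))) / 2) = c k j := by
    rw [hF, hF, map_mul, hc, Complex.conj_conj, Complex.conj_ofReal]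
    have : ((2 * Real.pi : ℝ) : ℂ) ≠ 0 := by simp [Real.pi_ne_zero]
    field_simp
    ring
  rw [coeff_add, coeff_realField, coeff_realField]
  fin_cases j
  · simpa using key
  · simpa using key

lemma summable_norm_coeff_sq (u : L2) (j : Fin 2) : Summable fun k => ‖coeff u k j‖ ^ 2 := by
  have h := (hasSum_norm_sq u).summable
  have h2 := (summable_mul_left_iff (by positivity)).1 h
  refine h2.of_nonneg_of_le (fun k => by positivity) fun k => ?_
  exact Finset.single_le_sum (f := fun j => ‖coeff u k j‖ ^ 2) (fun _ _ => by positivity)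
    (Finset.mem_univ j)

/-! ### Fourier multipliers with bounded even symbols -/

lemma IsMultiplier.multiplier {m : (Fin 2 → ℤ) → ℝ} {u f : L2} (h : IsMultiplier m u f) :
    IsMultiplier m u (multiplier m u) := by
  have h' : ∃ f, IsMultiplier m u f := ⟨f, h⟩
  rw [Intertwinement.multiplier, dif_pos h']
  exact h'.choose_spec

/-- A bounded even symbol. -/
structure IsSymbol (m : (Fin 2 → ℤ) → ℝ) : Prop where
  even : ∀ k, m (-k) = m k
  bounded : ∃ M, ∀ k, |m k| ≤ M

lemma IsSymbol.mul {m n : (Fin 2 → ℤ) → ℝ} (hm : IsSymbol m) (hn : IsSymbol n) :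
    IsSymbol fun k => m k * n k := by
  obtain ⟨M, hM⟩ := hm.bounded
  obtain ⟨N, hN⟩ := hn.bounded
  refine ⟨fun k => by rw [hm.even, hn.even], M * N, fun k => ?_⟩
  rw [abs_mul]
  exact mul_le_mul (hM k) (hN k) (abs_nonneg _) ((abs_nonneg _).trans (hM k))

/-- Boundedness keeps the coefficients square-summable and evenness keeps them Hermitian, so the
default value in `multiplier` is never taken. -/
lemma coeff_multiplier {m : (Fin 2 → ℤ) → ℝ} (hm : IsSymbol m) (u : L2) (k : Fin 2 → ℤ)
    (j : Fin 2) : coeff (multiplier m u) k j = m k * coeff u k j := by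
  obtain ⟨M, hM⟩ := hm.bounded
  obtain ⟨f, hf⟩ := exists_coeff_eq (c := fun k j => m k * coeff u k j)
    (fun k j => by simp only [map_mul, Complex.conj_ofReal, hm.even, coeff_neg]) fun j => by
      refine ((summable_norm_coeff_sq u j).mul_left (M ^ 2)).of_nonneg_of_le
        (fun k => by positivity) fun k => ?_
      rw [norm_mul, mul_pow, Complex.norm_real, Real.norm_eq_abs]
      gcongr
      exact hM k
  exact IsMultiplier.multiplier (f := f) hf k j

lemma norm_le_of_coeff_le {u v : L2} {M : ℝ} (hM : 0 ≤ M)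
    (h : ∀ k j, ‖coeff u k j‖ ≤ M * ‖coeff v k j‖) : ‖u‖ ≤ M * ‖v‖ := by
  have h1 := hasSum_norm_sq u
  have h2 := (hasSum_norm_sq v).mul_left (M ^ 2)
  have : ‖u‖ ^ 2 ≤ M ^ 2 * ‖v‖ ^ 2 := by
    refine hasSum_le (fun k => ?_) h1 h2
    rw [mul_left_comm (M ^ 2), Finset.mul_sum _ _ (M ^ 2)]
    refine mul_le_mul_of_nonneg_left (Finset.sum_le_sum fun j _ => ?_) (by positivity)
    rw [← mul_pow]
    exact pow_le_pow_left₀ (norm_nonneg _) (h k j) 2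
  rw [← mul_pow] at this
  exact (sq_le_sq₀ (norm_nonneg _) (by positivity)).1 this

lemma norm_multiplier_le {m : (Fin 2 → ℤ) → ℝ} (hm : IsSymbol m) {M : ℝ} (h : ∀ k, |m k| ≤ M)
    (u : L2) : ‖multiplier m u‖ ≤ M * ‖u‖ := by
  refine norm_le_of_coeff_le ((abs_nonneg _).trans (h 0)) fun k j => ?_
  rw [coeff_multiplier hm, norm_mul, Complex.norm_real, Real.norm_eq_abs]
  gcongr
  exact h k

lemma inner_multiplier {m : (Fin 2 → ℤ) → ℝ} (hm : IsSymbol m) (u v : L2) :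
    inner ℝ (multiplier m u) v = inner ℝ u (multiplier m v) := by
  refine (hasSum_inner _ _).unique ?_
  convert! hasSum_inner u (multiplier m v) using 2 with k
  congr 1
  refine Finset.sum_congr rfl fun j _ => ?_
  rw [coeff_multiplier hm, coeff_multiplier hm, map_mul, Complex.conj_ofReal, mul_assoc,
    mul_left_comm]

/-- The multiplier with a bounded even symbol as a continuous linear map. -/
def multiplierL {m : (Fin 2 → ℤ) → ℝ} (hm : IsSymbol m) : L2 →L[ℝ] L2 :=
  LinearMap.mkContinuous
    { toFun := multiplier m
      map_add' := fun u v => ext_coeff fun k j => by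
        simp only [coeff_multiplier hm, coeff_add, mul_add]
      map_smul' := fun c u => ext_coeff fun k j => by
        simp only [coeff_multiplier hm, coeff_smul, RingHom.id_apply, mul_left_comm] }
    hm.bounded.choose (norm_multiplier_le hm hm.bounded.choose_spec)

lemma waveSq_nonneg (k : Fin 2 → ℤ) : 0 ≤ waveSq k :=
  Finset.sum_nonneg fun _ _ => sq_nonneg _

lemma waveSq_neg (k : Fin 2 → ℤ) : waveSq (-k) = waveSq k := by simp [waveSq]

lemma one_le_waveSq {k : Fin 2 → ℤ} (hk : k ≠ 0) : 1 ≤ waveSq k := by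
  obtain ⟨i, hi⟩ := Function.ne_iff.1 hk
  have h1 : (1 : ℝ) ≤ (k i : ℝ) ^ 2 := by
    have : 0 < k i ^ 2 := sq_pos_of_ne_zero (by simpa using hi)
    exact_mod_cast (this : 1 ≤ k i ^ 2)
  exact h1.trans (Finset.single_le_sum (f := fun i => (k i : ℝ) ^ 2) (fun _ _ => sq_nonneg _)
    (Finset.mem_univ i))

open Classical in
/-- The indicator of the wave vectors with `|k| ≤ K`. -/
def lowSymbol (K : ℝ) (k : Fin 2 → ℤ) : ℝ := if √(waveSq k) ≤ K then 1 else 0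

lemma isSymbol_lowSymbol (K : ℝ) : IsSymbol (lowSymbol K) where
  even k := by rw [lowSymbol, lowSymbol, waveSq_neg]
  bounded := ⟨1, fun k => by rw [lowSymbol]; split_ifs <;> simp⟩

lemma isSymbol_highSymbol (K : ℝ) : IsSymbol fun k => 1 - lowSymbol K k where
  even k := by rw [(isSymbol_lowSymbol K).even]
  bounded := ⟨1, fun k => by rw [lowSymbol]; split_ifs <;> simp⟩

/-- The symbol `|k|²` truncated to `|k| ≤ N`. -/
lemma isSymbol_lowWaveSq (N : ℝ) : IsSymbol fun k => lowSymbol N k * waveSq k where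
  even k := by rw [(isSymbol_lowSymbol N).even, waveSq_neg]
  bounded := ⟨N ^ 2, fun k => by
    rw [lowSymbol]
    split_ifs with h
    · rw [one_mul, abs_of_nonneg (waveSq_nonneg k)]
      exact Real.sqrt_le_left ((Real.sqrt_nonneg _).trans h) |>.1 h
    · simp [sq_nonneg]⟩

lemma coeff_lowModes (K : ℝ) (u : L2) (k : Fin 2 → ℤ) (j : Fin 2) :
    coeff (lowModes K u) k j = lowSymbol K k * coeff u k j :=
  coeff_multiplier (isSymbol_lowSymbol K) u k j

lemma tendsto_lowSymbol (k : Fin 2 → ℤ) : Tendsto (fun N : ℕ => lowSymbol N k) atTop (𝓝 1) := by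
  refine tendsto_const_nhds.congr' ?_
  filter_upwards [eventually_ge_atTop ⌈√(waveSq k)⌉₊] with N hN
  rw [lowSymbol, if_pos ((Nat.le_ceil _).trans (by exact_mod_cast hN))]

lemma abs_one_sub_lowSymbol_le (K : ℝ) (k : Fin 2 → ℤ) : |1 - lowSymbol K k| ≤ 1 := by
  rw [lowSymbol]; split_ifs <;> simp

lemma abs_lowSymbol_le (K : ℝ) (k : Fin 2 → ℤ) : |lowSymbol K k| ≤ 1 := by
  rw [lowSymbol]; split_ifs <;> simp

/-- Dominated convergence in the Parseval sum of the remainder. -/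
lemma tendsto_lowModes (u : L2) : Tendsto (fun N : ℕ => lowModes N u) atTop (𝓝 u) := by
  rw [tendsto_iff_norm_sub_tendsto_zero]
  have h : Tendsto (fun N : ℕ => ‖lowModes N u - u‖ ^ 2) atTop (𝓝 0) := by
    have h1 : ∀ N : ℕ, ‖lowModes N u - u‖ ^ 2 =
        ∑' k, (2 * Real.pi) ^ 2 * ∑ j, ‖(1 - lowSymbol N k : ℝ) * coeff u k j‖ ^ 2 := by
      intro N
      rw [← (hasSum_norm_sq _).tsum_eq]
      refine tsum_congr fun k => ?_
      congr 1
      refine Finset.sum_congr rfl fun j _ => ?_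
      rw [coeff_sub, coeff_lowModes, norm_sub_rev]
      rw [← one_sub_mul]; push_cast; rfl
    simp_rw [h1]
    rw [← tsum_zero (α := ℝ) (β := Fin 2 → ℤ)]
    refine tendsto_tsum_of_dominated_convergence (hasSum_norm_sq u).summable (fun k => ?_)
      (Eventually.of_forall fun N k => ?_)
    · have h2 : Tendsto (fun N : ℕ => (2 * Real.pi) ^ 2 *
          ∑ j, ‖((1 - lowSymbol N k : ℝ) : ℂ) * coeff u k j‖ ^ 2) atTop
          (𝓝 ((2 * Real.pi) ^ 2 * ∑ j, ‖((1 - 1 : ℝ) : ℂ) * coeff u k j‖ ^ 2)) := by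
        refine Tendsto.const_mul _ (tendsto_finsetSum _ fun j _ => ?_)
        refine ((Tendsto.mul_const _ ?_).norm).pow 2
        exact (Complex.continuous_ofReal.tendsto _).comp
          (tendsto_const_nhds.sub (tendsto_lowSymbol k))
      simpa using h2
    · rw [Real.norm_of_nonneg (by positivity)]
      gcongr with j
      rw [norm_mul, Complex.norm_real, Real.norm_eq_abs]
      exact mul_le_of_le_one_left (norm_nonneg _) (abs_one_sub_lowSymbol_le _ _)
  have := h.sqrt
  simpa using this

/-- A scalar function is bounded by the sum of the moduli of its Fourier coefficients. -/
lemma ae_norm_le_of_hasSum {F : ScalarL2} {M : ℝ}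
    (h : HasSum (fun k => ‖fourierBasis.repr F k‖) M) :
    ∀ᵐ x ∂cellMeasure, ‖F x‖ ≤ (2 * Real.pi)⁻¹ * M := by
  have h1 := fourierBasis.hasSum_repr F
  have h2 := (tendstoInMeasure_of_tendsto_Lp h1).exists_seq_tendsto_ae'
  obtain ⟨ns, -, hns⟩ := h2
  have h3 : ∀ s : Finset (Fin 2 → ℤ), ∀ᵐ x ∂cellMeasure,
      ‖(∑ k ∈ s, fourierBasis.repr F k • fourierBasis k : ScalarL2) x‖ ≤ (2 * Real.pi)⁻¹ * M := by
    intro s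
    have h4 : ∀ᵐ x ∂cellMeasure, ∀ k : Fin 2 → ℤ,
        (fourierBasis.repr F k • fourierBasis k : ScalarL2) x =
          fourierBasis.repr F k * (((2 * Real.pi : ℝ) : ℂ)⁻¹ * wave k x) := by
      rw [ae_all_iff]
      intro k
      filter_upwards [coeFn_waveLp k, Lp.coeFn_smul (fourierBasis.repr F k) (waveLp k)]
        with x hx hy
      have : fourierBasis k = waveLp k := by simp [fourierBasis]
      rw [this, hy, Pi.smul_apply, hx, smul_eq_mul]
    filter_upwards [h4, Lp.coeFn_finsetSum s fun k => fourierBasis.repr F k • fourierBasis k]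
      with x hx hy
    rw [hy, Finset.sum_apply]
    calc ‖∑ k ∈ s, (fourierBasis.repr F k • fourierBasis k : ScalarL2) x‖
        ≤ ∑ k ∈ s, (2 * Real.pi)⁻¹ * ‖fourierBasis.repr F k‖ := by
          refine norm_sum_le_of_le _ fun k _ => ?_
          rw [hx, norm_mul, norm_mul, norm_wave, mul_one, norm_inv, Complex.norm_real,
            Real.norm_of_nonneg (by positivity), mul_comm]
      _ ≤ _ := by
          rw [← Finset.mul_sum]
          gcongr
          exact sum_le_hasSum s (fun _ _ => norm_nonneg _) h
  have h5 : ∀ᵐ x ∂cellMeasure, ∀ n : ℕ,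
      ‖(∑ k ∈ ns n, fourierBasis.repr F k • fourierBasis k : ScalarL2) x‖ ≤
        (2 * Real.pi)⁻¹ * M := ae_all_iff.2 fun n => h3 _
  filter_upwards [hns, h5] with x hx hx5
  exact le_of_tendsto hx.norm (Eventually.of_forall hx5)

lemma ae_abs_le_of_hasSum {u : L2} {j : Fin 2} {M : ℝ} (h : HasSum (fun k => ‖coeff u k j‖) M) :
    ∀ᵐ x ∂cellMeasure, |u x j| ≤ M := by
  have h1 : HasSum (fun k => ‖fourierBasis.repr (component j u) k‖) (2 * Real.pi * M) := by
    convert! h.mul_left (2 * Real.pi) using 2 with k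
    rw [coeff_eq_repr, norm_mul, norm_inv, Complex.norm_real, Real.norm_of_nonneg (by positivity),
      ← mul_assoc, mul_inv_cancel₀ (by positivity), one_mul]
  filter_upwards [ae_norm_le_of_hasSum h1, coeFn_component j u] with x h2 h3
  rwa [h3, Complex.norm_real, Real.norm_eq_abs, ← mul_assoc, inv_mul_cancel₀ (by positivity),
    one_mul] at h2

/-! ### Test functions, weak derivatives and the space `H` in Fourier terms -/

/-- The phase `k·x`. -/
def phase (k : Fin 2 → ℤ) : Plane →L[ℝ] ℝ := ∑ i, (k i : ℝ) • (EuclideanSpace.proj i : Plane →L[ℝ] ℝ)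

lemma phase_apply (k : Fin 2 → ℤ) (x : Plane) : phase k x = ∑ i, (k i : ℝ) * x i := by
  simp [phase]

lemma phase_single (k : Fin 2 → ℤ) (j : Fin 2) : phase k (EuclideanSpace.single j 1) = k j := by
  simp [phase_apply]

lemma phase_add_single (k : Fin 2 → ℤ) (j : Fin 2) (x : Plane) :
    phase k (x + EuclideanSpace.single j (2 * Real.pi)) = phase k x + k j * (2 * Real.pi) := by
  rw [map_add]
  congr 1
  simp [phase_apply]

lemma isTest_cos (k : Fin 2 → ℤ) : IsTest fun x => Real.cos (phase k x) where
  smooth := Real.contDiff_cos.comp (phase k).contDiff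
  periodic j x := by rw [phase_add_single, Real.cos_add_int_mul_two_pi]

lemma isTest_sin (k : Fin 2 → ℤ) : IsTest fun x => Real.sin (phase k x) where
  smooth := Real.contDiff_sin.comp (phase k).contDiff
  periodic j x := by rw [phase_add_single, Real.sin_add_int_mul_two_pi]

lemma IsTest.mul {φ ψ : Plane → ℝ} (hφ : IsTest φ) (hψ : IsTest ψ) : IsTest fun x => φ x * ψ x where
  smooth := hφ.smooth.mul hψ.smooth
  periodic i x := by rw [hφ.periodic, hψ.periodic]

lemma fderiv_cos_phase (k : Fin 2 → ℤ) (j : Fin 2) (x : Plane) :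
    fderiv ℝ (fun x => Real.cos (phase k x)) x (EuclideanSpace.single j 1) =
      -(k j * Real.sin (phase k x)) := by
  rw [((phase k).hasFDerivAt.cos).fderiv]
  simp [phase_single, mul_comm]

lemma fderiv_sin_phase (k : Fin 2 → ℤ) (j : Fin 2) (x : Plane) :
    fderiv ℝ (fun x => Real.sin (phase k x)) x (EuclideanSpace.single j 1) =
      k j * Real.cos (phase k x) := by
  rw [((phase k).hasFDerivAt.sin).fderiv]
  simp [phase_single, mul_comm]

lemma isCompact_cell : IsCompact cell := by
  have : cell = (PiLp.homeomorph 2 (fun _ : Fin 2 => ℝ)) ⁻¹'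
      Set.Icc (fun _ => 0) (fun _ => 2 * Real.pi) := by
    ext x
    simp only [cell, ← Set.pi_univ_Icc, Set.mem_preimage, Set.mem_pi, Set.mem_univ, true_implies]
    rfl
  rw [this, Homeomorph.isCompact_preimage]
  exact isCompact_Icc

lemma memLp_of_continuous {E : Type*} [NormedAddCommGroup E] {f : Plane → E} (hf : Continuous f)
    [SecondCountableTopologyEither Plane E] : MemLp f 2 cellMeasure := by
  obtain ⟨C, hC⟩ := isCompact_cell.exists_bound_of_continuousOn hf.continuousOn
  refine MemLp.of_bound hf.aestronglyMeasurable C ?_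
  exact (ae_restrict_iff' isCompact_cell.measurableSet).2 (Eventually.of_forall hC)

/-- The integral of a partial derivative of a periodic function over the period cell vanishes. -/
lemma IsTest.integral_fderiv {φ : Plane → ℝ} (hφ : IsTest φ) (j : Fin 2) :
    ∫ x in cell, fderiv ℝ φ x (EuclideanSpace.single j 1) = 0 := by
  have hd : ContDiff ℝ 1 φ := hφ.smooth.of_le (by simp)
  have hfd : Continuous (fderiv ℝ φ) := hd.continuous_fderiv (by simp)
  let e : (Fin 2 → ℝ) ≃L[ℝ] Plane := (EuclideanSpace.equiv (Fin 2) ℝ).symm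
  have hcell : e ⁻¹' cell = Set.Icc (fun _ => 0) (fun _ => 2 * Real.pi) := by
    ext x
    simp only [cell, ← Set.pi_univ_Icc, Set.mem_preimage, Set.mem_pi, Set.mem_univ, true_implies]
    rfl
  have hmp : MeasurePreserving e volume volume := PiLp.volume_preserving_toLp (Fin 2)
  rw [← hmp.setIntegral_preimage_emb e.toHomeomorph.measurableEmbedding, hcell]
  have he : ∀ i : Fin 2, e (Pi.single i 1) = EuclideanSpace.single i 1 := fun i => rfl
  -- Divergence theorem for the field whose only nonzero component is the `j`-th, equal to `φ`;
  -- periodicity then cancels the two opposite faces.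
  have key := integral_divergence_of_hasFDerivAt_off_countable' (n := 1)
    (fun _ => 0) (fun _ => 2 * Real.pi) (fun _ => by positivity)
    (fun i x => if i = j then φ (e x) else 0)
    (fun i x => if i = j then (fderiv ℝ φ (e x)).comp (e : (Fin 2 → ℝ) →L[ℝ] Plane) else 0)
    ∅ Set.countable_empty
    (fun i => by
      split_ifs
      · exact (hd.continuous.comp e.continuous).continuousOn
      · exact continuousOn_const)
    (fun x _ i => by
      split_ifs
      · exact ((hd.differentiable (by simp)).differentiableAt.hasFDerivAt).comp x e.hasFDerivAt
      · exact hasFDerivAt_const _ _)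
    (by
      refine Continuous.integrableOn_Icc ?_
      refine continuous_finsetSum _ fun i _ => ?_
      split_ifs
      · exact (hfd.comp e.continuous).clm_apply continuous_const
      · exact continuous_const)
  have hper : ∀ (i : Fin 2) (x : Fin 1 → ℝ), i = j → φ (e (i.insertNth (2 * Real.pi) x)) =
      φ (e (i.insertNth 0 x)) := by
    intro i x _
    refine Eq.trans (congrArg φ ?_) (hφ.periodic i _)
    ext l
    change (i.insertNth (2 * Real.pi) x : Fin 2 → ℝ) l = (i.insertNth (0 : ℝ) x : Fin 2 → ℝ) l +
      (EuclideanSpace.single i (2 * Real.pi) : Plane) l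
    refine Fin.succAboveCases i ?_ (fun m => ?_) l
    · simp
    · simp
  have hzero : ∀ i : Fin 2, (∫ x in Set.Icc ((fun _ : Fin 2 => (0:ℝ)) ∘ i.succAbove)
        ((fun _ : Fin 2 => 2 * Real.pi) ∘ i.succAbove),
        (if i = j then φ (e (i.insertNth (2 * Real.pi) x)) else 0)) -
      ∫ x in Set.Icc ((fun _ : Fin 2 => (0:ℝ)) ∘ i.succAbove)
        ((fun _ : Fin 2 => 2 * Real.pi) ∘ i.succAbove),
        (if i = j then φ (e (i.insertNth 0 x)) else 0) = 0 := by
    intro i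
    rw [sub_eq_zero]
    congr 1; ext x
    split_ifs with h
    · exact hper i x h
    · rfl
  have hr := key.trans (Finset.sum_eq_zero fun i _ => hzero i)
  refine Eq.trans (integral_congr_ae (Eventually.of_forall fun x => ?_)) hr
  simp only
  rw [Finset.sum_eq_single j]
  · simp [he]
  · intro i _ hi; simp [hi]
  · simp

lemma IsTest.integral_fderiv_mul {φ ψ : Plane → ℝ} (hφ : IsTest φ) (hψ : IsTest ψ) (j : Fin 2) :
    ∫ x in cell, fderiv ℝ φ x (EuclideanSpace.single j 1) * ψ x =
      -∫ x in cell, φ x * fderiv ℝ ψ x (EuclideanSpace.single j 1) := by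
  have hd : ContDiff ℝ 1 φ := hφ.smooth.of_le (by simp)
  have hd' : ContDiff ℝ 1 ψ := hψ.smooth.of_le (by simp)
  have h := (hφ.mul hψ).integral_fderiv j
  have h1 : ∀ x, fderiv ℝ (fun x => φ x * ψ x) x (EuclideanSpace.single j 1) =
      fderiv ℝ φ x (EuclideanSpace.single j 1) * ψ x +
        φ x * fderiv ℝ ψ x (EuclideanSpace.single j 1) := by
    intro x
    rw [fderiv_fun_mul (hd.differentiable (by simp)).differentiableAt
      (hd'.differentiable (by simp)).differentiableAt]
    simp; ring
  simp_rw [h1] at h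
  have hc : Continuous fun x => fderiv ℝ φ x (EuclideanSpace.single j 1) :=
    (hd.continuous_fderiv (by simp)).clm_apply continuous_const
  have hc' : Continuous fun x => fderiv ℝ ψ x (EuclideanSpace.single j 1) :=
    (hd'.continuous_fderiv (by simp)).clm_apply continuous_const
  rw [integral_add] at h
  · linarith
  · exact (hc.mul hd'.continuous).continuousOn.integrableOn_compact isCompact_cell
  · exact (hd.continuous.mul hc').continuousOn.integrableOn_compact isCompact_cell

lemma integrable_test_mul {φ : Plane → ℝ} (hφ : Continuous φ) (u : L2) (j : Fin 2) :
    Integrable (fun x => φ x * u x j) cellMeasure := by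
  have h1 : MemLp (fun x => u x j) 2 cellMeasure :=
    (EuclideanSpace.proj j : Plane →L[ℝ] ℝ).comp_memLp' (Lp.memLp u)
  exact (memLp_of_continuous hφ).integrable_mul h1

lemma coeff_eq_cos_sin (u : L2) (k : Fin 2 → ℤ) (j : Fin 2) :
    coeff u k j = ((2 * Real.pi : ℝ) : ℂ)⁻¹ ^ 2 *
      (((∫ x in cell, Real.cos (phase k x) * u x j : ℝ) : ℂ) -
        Complex.I * ((∫ x in cell, Real.sin (phase k x) * u x j : ℝ) : ℂ)) := by
  rw [coeff, ← integral_complex_ofReal, ← integral_complex_ofReal,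
    ← integral_const_mul Complex.I, ← integral_sub]
  · congr 2; ext x
    rw [← phase_apply, ← mul_neg, mul_comm Complex.I, ← Complex.ofReal_neg, Complex.exp_mul_I,
      ← Complex.ofReal_cos, ← Complex.ofReal_sin, Real.cos_neg, Real.sin_neg]
    push_cast; ring
  · exact (integrable_test_mul (isTest_cos k).smooth.continuous u j).ofReal
  · exact ((integrable_test_mul (isTest_sin k).smooth.continuous u j).ofReal).const_mul _

lemma integral_smul_apply {φ : Plane → ℝ} (hφ : Continuous φ) (u : L2) (j : Fin 2) :
    (∫ x in cell, φ x • u x) j = ∫ x in cell, φ x * u x j := by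
  have h : Integrable (fun x => φ x • u x) cellMeasure :=
    (Lp.memLp u).smul (memLp_of_continuous hφ) |>.integrable le_rfl
  exact ((EuclideanSpace.proj j : Plane →L[ℝ] ℝ).integral_comp_comm h).symm

/-- Testing with `cos(k·x)` and `sin(k·x)` suffices. In particular the coefficients of a weak
derivative are determined, whichever witness `weakDeriv` selects. -/
lemma IsWeakDeriv.coeff_eq {j : Fin 2} {u f : L2} (h : IsWeakDeriv j u f) (k : Fin 2 → ℤ)
    (i : Fin 2) : coeff f k i = Complex.I * k j * coeff u k i := by
  have h1 := congrArg (fun y : Plane => y i) (h _ (isTest_cos k))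
  have h2 := congrArg (fun y : Plane => y i) (h _ (isTest_sin k))
  have hc := (isTest_cos k).smooth.continuous
  have hs := (isTest_sin k).smooth.continuous
  simp only [fderiv_cos_phase, fderiv_sin_phase, PiLp.neg_apply] at h1 h2
  rw [integral_smul_apply hc, integral_smul_apply (by fun_prop)] at h1
  rw [integral_smul_apply hs, integral_smul_apply (by fun_prop)] at h2
  simp only [neg_mul, integral_neg, mul_assoc, integral_const_mul, neg_inj] at h1 h2
  rw [coeff_eq_cos_sin, coeff_eq_cos_sin, ← h1, ← neg_eq_iff_eq_neg.2 h2]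
  generalize ((2 * Real.pi : ℝ) : ℂ)⁻¹ ^ 2 = c
  push_cast
  linear_combination (c * (k j : ℂ) *
    ((∫ x in cell, Real.sin (phase k x) * u x i : ℝ) : ℂ)) * Complex.I_sq

lemma coeff_weakDeriv {u : L2} (hu : MemV u) (j : Fin 2) (k : Fin 2 → ℤ) (i : Fin 2) :
    coeff (weakDeriv j u) k i = Complex.I * k j * coeff u k i := by
  have h : IsWeakDeriv j u (weakDeriv j u) := by
    rw [weakDeriv, dif_pos (hu.2 j)]
    exact (hu.2 j).choose_spec
  exact h.coeff_eq k i

lemma inner_eq_zero_of_mem_H {u w : L2} (hu : u ∈ H) (hw : w ∈ constOrGradient) :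
    inner ℝ w u = 0 :=
  (Submodule.mem_orthogonal _ _).1 hu w (Submodule.subset_span hw)

lemma coeff_zero_of_mem_H {u : L2} (hu : u ∈ H) (j : Fin 2) : coeff u 0 j = 0 := by
  have hm : MemLp (fun _ : Plane => EuclideanSpace.single j (1 : ℝ)) 2 cellMeasure := memLp_const _
  have h := inner_eq_zero_of_mem_H hu (w := hm.toLp _)
    (Or.inl ⟨_, hm.coeFn_toLp⟩)
  rw [L2.inner_def] at h
  have h2 : ∫ x in cell, u x j = 0 := by
    rw [← h]
    refine integral_congr_ae ?_
    filter_upwards [hm.coeFn_toLp] with x hx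
    rw [hx, EuclideanSpace.inner_single_left]
    simp
  rw [coeff_eq_cos_sin]
  simp [phase, h2]

lemma gradient_apply {φ : Plane → ℝ} (x : Plane) (j : Fin 2) :
    gradient φ x j = fderiv ℝ φ x (EuclideanSpace.single j 1) := by
  have h : inner ℝ (gradient φ x) (EuclideanSpace.single j (1 : ℝ)) =
      fderiv ℝ φ x (EuclideanSpace.single j 1) := by
    rw [gradient, InnerProductSpace.toDual_symm_apply]
  rw [← h, EuclideanSpace.inner_single_right]
  simp

lemma continuous_gradient {φ : Plane → ℝ} (hφ : IsTest φ) : Continuous (gradient φ) := by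
  have hd : ContDiff ℝ 1 φ := hφ.smooth.of_le (by simp)
  exact (InnerProductSpace.toDual ℝ Plane).symm.continuous.comp (hd.continuous_fderiv (by simp))

lemma sum_integral_fderiv_eq_zero {u : L2} (hu : u ∈ H) {φ : Plane → ℝ} (hφ : IsTest φ) :
    ∑ j, ∫ x in cell, fderiv ℝ φ x (EuclideanSpace.single j 1) * u x j = 0 := by
  have hm : MemLp (gradient φ) 2 cellMeasure := memLp_of_continuous (continuous_gradient hφ)
  have h := inner_eq_zero_of_mem_H hu (w := hm.toLp _)
    (Or.inr ⟨φ, hφ, hm.coeFn_toLp⟩)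
  rw [L2.inner_def] at h
  have hd : ContDiff ℝ 1 φ := hφ.smooth.of_le (by simp)
  rw [← h, ← integral_finsetSum]
  · refine integral_congr_ae ?_
    filter_upwards [hm.coeFn_toLp] with x hx
    rw [hx, PiLp.inner_apply]
    refine Finset.sum_congr rfl fun j _ => ?_
    rw [gradient_apply, RCLike.inner_apply, mul_comm]
    rfl
  · intro j _
    exact integrable_test_mul ((hd.continuous_fderiv (by simp)).clm_apply continuous_const) u j

lemma divergence_coeff_of_mem_H {u : L2} (hu : u ∈ H) (k : Fin 2 → ℤ) :
    ∑ j, (k j : ℂ) * coeff u k j = 0 := by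
  have h1 := sum_integral_fderiv_eq_zero hu (isTest_cos k)
  have h2 := sum_integral_fderiv_eq_zero hu (isTest_sin k)
  simp only [fderiv_cos_phase, fderiv_sin_phase, neg_mul, integral_neg, mul_assoc,
    integral_const_mul, Finset.sum_neg_distrib, neg_eq_zero] at h1 h2
  have h1' := congrArg (fun r : ℝ => (r : ℂ)) h1
  have h2' := congrArg (fun r : ℝ => (r : ℂ)) h2
  simp only [coeff_eq_cos_sin, Fin.sum_univ_two] at h1' h2' ⊢
  generalize ((2 * Real.pi : ℝ) : ℂ)⁻¹ ^ 2 = c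
  push_cast at h1' h2' ⊢
  linear_combination c * h2' - c * Complex.I * h1'

/-- Integration by parts: the coefficients of a gradient are parallel to `k`, hence orthogonal to
divergence-free amplitudes. -/
lemma coeff_of_ae_eq_gradient {φ : Plane → ℝ} (hφ : IsTest φ) {w : L2}
    (hw : ∀ᵐ x ∂cellMeasure, w x = gradient φ x) (k : Fin 2 → ℤ) :
    ∃ c : ℂ, ∀ j, coeff w k j = k j * c := by
  refine ⟨((2 * Real.pi : ℝ) : ℂ)⁻¹ ^ 2 * (((∫ x in cell, φ x * Real.sin (phase k x) : ℝ) : ℂ) +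
    Complex.I * ((∫ x in cell, φ x * Real.cos (phase k x) : ℝ) : ℂ)), fun j => ?_⟩
  have e : ∀ ψ : Plane → ℝ, ∫ x in cell, ψ x * w x j =
      ∫ x in cell, fderiv ℝ φ x (EuclideanSpace.single j 1) * ψ x := by
    intro ψ
    refine integral_congr_ae ?_
    filter_upwards [hw] with x hx
    rw [hx, gradient_apply, mul_comm]
  rw [coeff_eq_cos_sin, e, e, hφ.integral_fderiv_mul (isTest_cos k),
    hφ.integral_fderiv_mul (isTest_sin k)]
  simp only [fderiv_cos_phase, fderiv_sin_phase, mul_neg, integral_neg, mul_left_comm _ (k j : ℝ),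
    integral_const_mul]
  generalize ((2 * Real.pi : ℝ) : ℂ)⁻¹ ^ 2 = c
  push_cast
  ring

/-- By Parseval: a constant field has only the mode `k = 0`, and a gradient has coefficients
parallel to `k`, so every term of the inner product is zero. -/
lemma mem_H_of_coeff {u : L2} (h0 : ∀ j, coeff u 0 j = 0)
    (hdiv : ∀ k, ∑ j, (k j : ℂ) * coeff u k j = 0) : u ∈ H := by
  rw [H, Submodule.mem_orthogonal]
  have key : ∀ w ∈ constOrGradient, inner ℝ w u = 0 := by
    rintro w (⟨c, hc⟩ | ⟨φ, hφ, hw⟩)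
    · refine (hasSum_inner w u).unique ?_
      convert! hasSum_zero using 2 with k
      rcases eq_or_ne k 0 with rfl | hk
      · simp [h0]
      · have : ∀ j, coeff w k j = 0 := by
          intro j
          have h1 : coeff w k j = ((2 * Real.pi : ℝ) : ℂ)⁻¹ ^ 2 *
              ∫ x in cell, ((c j : ℝ) : ℂ) * wave (-k) x := by
            rw [coeff]
            congr 1
            refine integral_congr_ae ?_
            filter_upwards [hc] with x hx
            rw [hx, ← conj_wave, wave, ← Complex.exp_conj]
            simp
          rw [h1, integral_const_mul, integral_wave, if_neg (neg_ne_zero.2 hk)]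
          simp
        simp [this]
    · refine (hasSum_inner w u).unique ?_
      convert! hasSum_zero using 2 with k
      obtain ⟨c, hc⟩ := coeff_of_ae_eq_gradient hφ hw k
      have : ∑ j, conj (coeff w k j) * coeff u k j = conj c * ∑ j, (k j : ℂ) * coeff u k j := by
        rw [Finset.mul_sum]
        refine Finset.sum_congr rfl fun j _ => ?_
        rw [hc, map_mul, map_intCast]; ring
      rw [← Complex.re_sum, this, hdiv, mul_zero, Complex.zero_re, mul_zero]
  intro w hw
  induction hw using Submodule.span_induction with
  | mem w hw => exact key w hw
  | zero => exact inner_zero_left _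
  | add x y _ _ hx hy => rw [inner_add_left, hx, hy, add_zero]
  | smul c x _ hx => rw [inner_smul_left, hx, mul_zero]

/-- A field whose Fourier coefficients are multiples of those of a field in `H` lies in `H`. -/
lemma IsMultiplier.mem_H {m : (Fin 2 → ℤ) → ℝ} {u f : L2} (h : IsMultiplier m u f) (hu : u ∈ H) :
    f ∈ H := by
  refine mem_H_of_coeff (fun j => by rw [h, coeff_zero_of_mem_H hu, mul_zero]) fun k => ?_
  simp only [h k, mul_left_comm _ (m k : ℂ), ← Finset.mul_sum, divergence_coeff_of_mem_H hu,
    mul_zero]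

lemma inner_leray {w c : L2} (hc : c ∈ H) : inner ℝ (leray w) c = inner ℝ w c := by
  rw [leray, Submodule.inner_starProjection_left_eq_right,
    Submodule.starProjection_eq_self_iff.2 hc]

lemma norm_leray_le (w : L2) : ‖leray w‖ ≤ ‖w‖ := H.norm_starProjection_apply_le w

/-! ### Lattice sums over square shells -/

/-- The maximum norm of a wave vector. -/
def shell (k : Fin 2 → ℤ) : ℕ := max (k 0).natAbs (k 1).natAbs

lemma shell_sq_le_waveSq (k : Fin 2 → ℤ) : (shell k : ℝ) ^ 2 ≤ waveSq k := by
  have h : ∀ i, (((k i).natAbs : ℕ) : ℝ) ^ 2 = (k i : ℝ) ^ 2 := by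
    intro i; rw [Nat.cast_natAbs, Int.cast_abs, sq_abs]
  rw [waveSq, Fin.sum_univ_two, ← h, ← h, shell]
  rcases max_cases (k 0).natAbs (k 1).natAbs with ⟨h, -⟩ | ⟨h, -⟩ <;> rw [h] <;>
    nlinarith [sq_nonneg (((k 0).natAbs : ℕ) : ℝ), sq_nonneg (((k 1).natAbs : ℕ) : ℝ)]

lemma waveSq_le_shell_sq (k : Fin 2 → ℤ) : waveSq k ≤ 2 * (shell k : ℝ) ^ 2 := by
  have h : ∀ i, (((k i).natAbs : ℕ) : ℝ) ^ 2 = (k i : ℝ) ^ 2 := by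
    intro i; rw [Nat.cast_natAbs, Int.cast_abs, sq_abs]
  have h0 : (((k 0).natAbs : ℕ) : ℝ) ≤ shell k := by exact_mod_cast le_max_left _ _
  have h1 : (((k 1).natAbs : ℕ) : ℝ) ≤ shell k := by exact_mod_cast le_max_right _ _
  rw [waveSq, Fin.sum_univ_two, ← h, ← h, two_mul]
  gcongr

/-- The boundary of the square of side `2n` carries exactly `8n` lattice points. -/
lemma card_filter_shell_le (s : Finset (Fin 2 → ℤ)) {n : ℕ} (hn : n ≠ 0) :
    (s.filter fun k => shell k = n).card ≤ 8 * n := by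
  rw [← Int.card_box hn]
  refine Finset.card_le_card_of_injOn (fun k => (k 0, k 1)) (fun k hk => ?_) ?_
  · have := (Finset.mem_filter.1 hk).2
    simpa [shell] using this
  · intro k _ l _ h
    simp only [Prod.mk.injEq] at h
    ext i
    fin_cases i
    · exact h.1
    · exact h.2

/-- Lattice sums of functions of the maximum norm. -/
lemma sum_shell_le (s : Finset (Fin 2 → ℤ)) {h : ℕ → ℝ} (h0 : h 0 = 0) (hp : ∀ n, 0 ≤ h n) :
    ∃ N : ℕ, ∑ k ∈ s, h (shell k) ≤ ∑ n ∈ Finset.range N, 8 * n * h n := by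
  refine ⟨(s.image shell).sup id + 1, ?_⟩
  rw [Finset.sum_comp]
  have hsub : s.image shell ⊆ Finset.range ((s.image shell).sup id + 1) := fun n hn =>
    Finset.mem_range_succ_iff.2 (Finset.le_sup (f := id) hn)
  calc _ ≤ ∑ n ∈ s.image shell, 8 * n * h n := by
        refine Finset.sum_le_sum fun n _ => ?_
        rcases eq_or_ne n 0 with rfl | hn
        · simp [h0]
        · rw [nsmul_eq_mul]
          exact mul_le_mul_of_nonneg_right (by exact_mod_cast card_filter_shell_le s hn) (hp n)
    _ ≤ _ := Finset.sum_le_sum_of_subset_of_nonneg hsub fun n _ _ =>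
        mul_nonneg (by positivity) (hp n)

/-- The shell of radius `n` contributes at most `8n · n⁻²`, so the sum is at most eight times a
harmonic number; `1 + ln K ≤ 2 ln(e + K)` gives 16. The logarithm in the theorem originates here.
The mode `k = 0` contributes nothing since `0⁻¹ = 0`. -/
lemma sum_low_inv_waveSq_le (K : ℝ) (hK : 0 < K) (s : Finset (Fin 2 → ℤ)) :
    ∑ k ∈ s, lowSymbol K k * (waveSq k)⁻¹ ≤ 16 * Real.log (Real.exp 1 + K) := by
  let h : ℕ → ℝ := fun n => if (n : ℝ) ≤ K then ((n : ℝ) ^ 2)⁻¹ else 0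
  obtain ⟨N, hN⟩ := sum_shell_le s (h := h) (by simp [h])
    (fun n => by simp only [h]; split_ifs <;> positivity)
  have h1 : ∑ k ∈ s, lowSymbol K k * (waveSq k)⁻¹ ≤ ∑ k ∈ s, h (shell k) := by
    refine Finset.sum_le_sum fun k _ => ?_
    simp only [lowSymbol, h]
    by_cases hk : √(waveSq k) ≤ K
    · have : (shell k : ℝ) ≤ K := (Real.le_sqrt_of_sq_le (shell_sq_le_waveSq k)).trans hk
      rw [if_pos hk, if_pos this, one_mul]
      rcases Nat.eq_zero_or_pos (shell k) with h0 | h0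
      · have := waveSq_le_shell_sq k
        rw [h0] at this ⊢
        have h2 : waveSq k = 0 := le_antisymm (by simpa using this) (waveSq_nonneg k)
        simp [h2]
      · exact inv_anti₀ (by positivity) (shell_sq_le_waveSq k)
    · rw [if_neg hk, zero_mul]
      split_ifs <;> positivity
  have h2 : ∑ n ∈ Finset.range N, 8 * n * h n ≤ 8 * (harmonic ⌊K⌋₊ : ℝ) := by
    have h3 : ∀ n : ℕ, 8 * n * h n = if n ∈ Finset.Icc 1 ⌊K⌋₊ then 8 * (n : ℝ)⁻¹ else 0 := by
      intro n
      simp only [h, Finset.mem_Icc, Nat.le_floor_iff hK.le]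
      rcases Nat.eq_zero_or_pos n with rfl | hn
      · simp
      · by_cases hnK : (n : ℝ) ≤ K
        · rw [if_pos hnK, if_pos ⟨hn, hnK⟩]; field_simp
        · rw [if_neg hnK, if_neg (fun h => hnK h.2), mul_zero]
    rw [Finset.sum_congr rfl fun n _ => h3 n, ← Finset.sum_filter, harmonic_eq_sum_Icc]
    push_cast
    rw [Finset.mul_sum]
    refine Finset.sum_le_sum_of_subset_of_nonneg (fun n hn => (Finset.mem_filter.1 hn).2) ?_
    intros; positivity
  have h3 : (harmonic ⌊K⌋₊ : ℝ) ≤ 1 + Real.log ⌊K⌋₊ := harmonic_le_one_add_log _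
  have he : 1 ≤ Real.exp 1 := Real.one_le_exp (by norm_num)
  have h4 : Real.log ⌊K⌋₊ ≤ Real.log (Real.exp 1 + K) := by
    rcases Nat.eq_zero_or_pos ⌊K⌋₊ with h0 | h0
    · rw [h0, Nat.cast_zero, Real.log_zero]
      exact Real.log_nonneg (by linarith)
    · refine Real.log_le_log (by positivity) ((Nat.floor_le hK.le).trans (by linarith))
  have h5 : 1 ≤ Real.log (Real.exp 1 + K) := by
    rw [← Real.log_exp 1]
    exact Real.log_le_log (Real.exp_pos 1) (by rw [Real.log_exp]; linarith)
  linarith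

/-- Shells reached by `|k| > K` satisfy `2n² > K²`, and each contributes at most `8n · n⁻⁴`, a tail
of order `K⁻²`. -/
lemma sum_high_inv_waveSq_sq_le (K : ℝ) (hK : 0 < K) (s : Finset (Fin 2 → ℤ)) :
    ∑ k ∈ s, (1 - lowSymbol K k) * ((waveSq k)⁻¹) ^ 2 ≤ 32 / K ^ 2 := by
  let h : ℕ → ℝ := fun n => if K ^ 2 < 2 * (n : ℝ) ^ 2 then (((n : ℝ) ^ 2)⁻¹) ^ 2 else 0
  obtain ⟨N, hN⟩ := sum_shell_le s (h := h)
    (by simp [h])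
    (fun n => by simp only [h]; split_ifs <;> positivity)
  have h1 : ∑ k ∈ s, (1 - lowSymbol K k) * ((waveSq k)⁻¹) ^ 2 ≤ ∑ k ∈ s, h (shell k) := by
    refine Finset.sum_le_sum fun k _ => ?_
    simp only [lowSymbol, h]
    by_cases hk : √(waveSq k) ≤ K
    · rw [if_pos hk, sub_self, zero_mul]
      split_ifs <;> positivity
    · have h2 : K ^ 2 < waveSq k := (Real.lt_sqrt hK.le).1 (not_le.1 hk)
      have h3 := h2.trans_le (waveSq_le_shell_sq k)
      have h4 : 0 < (shell k : ℝ) ^ 2 := by nlinarith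
      rw [if_neg hk, if_pos h3, sub_zero, one_mul]
      exact pow_le_pow_left₀ (inv_nonneg.2 (waveSq_nonneg k))
        (inv_anti₀ h4 (shell_sq_le_waveSq k)) 2
  -- A telescoping majorant: `8n⁻³ ≤ 16 (n⁻² - (n+1)⁻²)` for `n ≥ 1`. Truncation at `K²/2` makes it
  -- constant below the tail, so the whole sum is at most `16 G(0) = 32/K²`.
  let G : ℕ → ℝ := fun n => (max ((n : ℝ) ^ 2) (K ^ 2 / 2))⁻¹
  have hG : ∀ n, 0 < max ((n : ℝ) ^ 2) (K ^ 2 / 2) := fun n => lt_max_of_lt_right (by positivity)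
  have h2 : ∀ n : ℕ, 8 * n * h n ≤ 16 * (G n - G (n + 1)) := by
    intro n
    simp only [h]
    split_ifs with hn
    · have hn0 : 0 < (n : ℝ) := by
        rcases Nat.eq_zero_or_pos n with rfl | h
        · norm_num at hn; nlinarith
        · exact_mod_cast h
      have e1 : G n = ((n : ℝ) ^ 2)⁻¹ := by
        simp only [G]; rw [max_eq_left (by linarith)]
      have e2 : G (n + 1) = (((n : ℝ) + 1) ^ 2)⁻¹ := by
        simp only [G]; push_cast; rw [max_eq_left (by nlinarith)]
      have hn1 : (1 : ℝ) ≤ n := by exact_mod_cast hn0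
      rw [e1, e2, inv_sub_inv (by positivity) (by positivity), ← one_div, div_pow, mul_div_assoc',
        mul_div_assoc', div_le_div_iff₀ (by positivity) (by positivity)]
      have : 0 ≤ (n : ℝ) ^ 3 * (2 * (2 * n + 1) * n - (n + 1) ^ 2) := by
        apply mul_nonneg (by positivity); nlinarith
      nlinarith
    · have : G (n + 1) ≤ G n := by
        refine inv_anti₀ (hG n) (max_le_max ?_ le_rfl)
        push_cast; gcongr; linarith
      simp; linarith
  have h3 : ∑ n ∈ Finset.range N, 8 * n * h n ≤ 16 * (G 0 - G N) := by
    rw [← Finset.sum_range_sub', Finset.mul_sum]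
    exact Finset.sum_le_sum fun n _ => h2 n
  have h4 : G 0 = 2 / K ^ 2 := by
    simp only [G]; rw [max_eq_right (by simp; positivity), inv_div]
  have h5 : 0 ≤ G N := (inv_pos.2 (hG N)).le
  calc _ ≤ 16 * (G 0 - G N) := h1.trans (hN.trans h3)
    _ ≤ 16 * G 0 := by linarith
    _ = 32 / K ^ 2 := by rw [h4]; ring

/-! ### Sup-norm estimates -/

/-- `u` is a field in `H` with first derivatives `d` and `A u = w`, on the level of Fourier
coefficients. -/
structure IsRegular (u : L2) (d : Fin 2 → L2) (w : L2) : Prop where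
  mem : u ∈ H
  deriv : ∀ i k j, coeff (d i) k j = Complex.I * k i * coeff u k j
  stokes : IsMultiplier waveSq u w

lemma IsRegular.multiplier {u w : L2} {d : Fin 2 → L2} (h : IsRegular u d w)
    {m : (Fin 2 → ℤ) → ℝ} (hm : IsSymbol m) :
    IsRegular (multiplier m u) (fun i => multiplier m (d i)) (multiplier m w) where
  mem := IsMultiplier.mem_H (coeff_multiplier hm u) h.mem
  deriv i k j := by
    rw [coeff_multiplier hm, coeff_multiplier hm, h.deriv]; ring
  stokes k j := by
    rw [coeff_multiplier hm, coeff_multiplier hm, h.stokes]; ring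

lemma sum_norm_coeff_sq_le (u : L2) (j : Fin 2) (s : Finset (Fin 2 → ℤ)) :
    ∑ k ∈ s, ‖coeff u k j‖ ^ 2 ≤ ‖u‖ ^ 2 := by
  have hpi : 1 ≤ (2 * Real.pi) ^ 2 := by nlinarith [Real.pi_gt_three]
  refine le_trans (Finset.sum_le_sum fun k _ => ?_)
    (sum_le_hasSum s (fun k _ => by positivity) (hasSum_norm_sq u))
  calc ‖coeff u k j‖ ^ 2 ≤ ∑ j, ‖coeff u k j‖ ^ 2 :=
        Finset.single_le_sum (f := fun j => ‖coeff u k j‖ ^ 2) (fun _ _ => by positivity)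
          (Finset.mem_univ j)
    _ ≤ _ := le_mul_of_one_le_left (by positivity) hpi

/-- Cauchy–Schwarz bounds the sum of the moduli of the coefficients, which dominates each component
pointwise; the factor 2 crudely combines the two components. -/
lemma ae_norm_le_of_sum_le {u : L2} {a : (Fin 2 → ℤ) → ℝ} {b : (Fin 2 → ℤ) → Fin 2 → ℝ} {A B : ℝ}
    (hA : 0 ≤ A) (hB : 0 ≤ B)
    (h : ∀ k j, ‖coeff u k j‖ ≤ a k * b k j) (ha : ∀ s : Finset _, ∑ k ∈ s, a k ^ 2 ≤ A ^ 2)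
    (hb : ∀ (s : Finset _) j, ∑ k ∈ s, b k j ^ 2 ≤ B ^ 2) :
    ∀ᵐ x ∂cellMeasure, ‖u x‖ ≤ 2 * (A * B) := by
  have h1 : ∀ j (s : Finset (Fin 2 → ℤ)), ∑ k ∈ s, ‖coeff u k j‖ ≤ A * B := by
    intro j s
    have h2 := Finset.sum_mul_sq_le_sq_mul_sq s a (fun k => b k j)
    have h3 : ∑ k ∈ s, ‖coeff u k j‖ ≤ ∑ k ∈ s, a k * b k j := Finset.sum_le_sum fun k _ => h k j
    refine h3.trans (abs_le_of_sq_le_sq' ?_ (by positivity)).2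
    calc _ ≤ (∑ k ∈ s, a k ^ 2) * ∑ k ∈ s, b k j ^ 2 := h2
      _ ≤ A ^ 2 * B ^ 2 := mul_le_mul (ha s) (hb s j) (Finset.sum_nonneg fun _ _ => sq_nonneg _)
          (by positivity)
      _ = (A * B) ^ 2 := by ring
  have h4 : ∀ j, ∀ᵐ x ∂cellMeasure, |u x j| ≤ A * B := by
    intro j
    have hs : Summable fun k => ‖coeff u k j‖ :=
      summable_of_sum_le (fun _ => norm_nonneg _) (h1 j)
    filter_upwards [ae_abs_le_of_hasSum hs.hasSum] with x hx
    exact hx.trans (hs.tsum_le_of_sum_le (h1 j))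
  filter_upwards [h4 0, h4 1] with x h5 h6
  rw [EuclideanSpace.norm_eq, Fin.sum_univ_two]
  refine Real.sqrt_le_iff.2 ⟨by positivity, ?_⟩
  have h7 : ‖u x 0‖ ^ 2 ≤ (A * B) ^ 2 := pow_le_pow_left₀ (norm_nonneg _) h5 2
  have h8 : ‖u x 1‖ ^ 2 ≤ (A * B) ^ 2 := pow_le_pow_left₀ (norm_nonneg _) h6 2
  nlinarith [sq_nonneg (A * B)]

/-- Fields without Fourier modes `|k| ≤ K` satisfy `|u|_∞ ≤ C K⁻¹ |A u|`. -/
lemma ae_norm_le_high {u w : L2} (hw : IsMultiplier waveSq u w) {K : ℝ} (hK : 0 < K)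
    (hu : ∀ k j, lowSymbol K k * coeff u k j = 0) :
    ∀ᵐ x ∂cellMeasure, ‖u x‖ ≤ 12 / K * ‖w‖ := by
  -- Split `|û_k| = |k|⁻² · |ŵ_k|` on the modes `|k| > K`; the constant 6 covers `32 ≤ 6²`.
  have h := ae_norm_le_of_sum_le (u := u) (a := fun k => (1 - lowSymbol K k) * (waveSq k)⁻¹)
    (b := fun k j => ‖coeff w k j‖) (A := 6 / K) (B := ‖w‖) (by positivity) (by positivity) ?_ ?_
    (fun s j => sum_norm_coeff_sq_le w j s)
  · filter_upwards [h] with x hx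
    convert hx using 1; ring
  · intro k j
    have h1 := hu k j
    rw [hw, norm_mul, Complex.norm_real, Real.norm_of_nonneg (waveSq_nonneg k)]
    rw [lowSymbol] at h1 ⊢
    split_ifs at h1 ⊢ with hk
    · have : coeff u k j = 0 := by simpa using h1
      simp [this]
    · have : 0 < waveSq k := by
        by_contra h0
        have : waveSq k = 0 := le_antisymm (not_lt.1 h0) (waveSq_nonneg k)
        rw [this, Real.sqrt_zero] at hk
        exact hk hK.le
      rw [sub_zero, one_mul, ← mul_assoc, inv_mul_cancel₀ this.ne', one_mul]
  · intro s
    calc ∑ k ∈ s, ((1 - lowSymbol K k) * (waveSq k)⁻¹) ^ 2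
        = ∑ k ∈ s, (1 - lowSymbol K k) * ((waveSq k)⁻¹) ^ 2 := by
          refine Finset.sum_congr rfl fun k _ => ?_
          rw [lowSymbol]; split_ifs <;> ring
      _ ≤ 32 / K ^ 2 := sum_high_inv_waveSq_sq_le K hK s
      _ ≤ (6 / K) ^ 2 := by rw [div_pow]; gcongr; norm_num

/-- Fields in `H` satisfy `|u|_∞ ≤ C |A u|`. -/
lemma ae_norm_le_stokes {u w : L2} (hu : u ∈ H) (hw : IsMultiplier waveSq u w) :
    ∀ᵐ x ∂cellMeasure, ‖u x‖ ≤ 24 * ‖w‖ := by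
  -- Nonzero wave vectors have `|k| ≥ 1`, so a mean-free field has no modes with `|k| ≤ 1/2`.
  have h := ae_norm_le_high hw (K := 1 / 2) (by norm_num) fun k j => ?_
  · norm_num at h; exact h
  · rcases eq_or_ne k 0 with rfl | hk
    · rw [coeff_zero_of_mem_H hu, mul_zero]
    · have : ¬ √(waveSq k) ≤ 1 / 2 := by
        have := Real.one_le_sqrt.2 (one_le_waveSq hk)
        linarith
      rw [lowSymbol, if_neg this]; simp

lemma norm_coeff_deriv_sq {u : L2} {d : Fin 2 → L2}
    (hd : ∀ i k j, coeff (d i) k j = Complex.I * k i * coeff u k j) (k : Fin 2 → ℤ) (j : Fin 2) :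
    ∑ i, ‖coeff (d i) k j‖ ^ 2 = waveSq k * ‖coeff u k j‖ ^ 2 := by
  rw [waveSq, Finset.sum_mul]
  refine Finset.sum_congr rfl fun i _ => ?_
  rw [hd, norm_mul, norm_mul, Complex.norm_I, one_mul, mul_pow, Complex.norm_intCast, sq_abs]

/-- Low-mode fields satisfy `|u|_∞ ≤ C (ln (e + K))^{1/2} ‖u‖`. -/
lemma ae_norm_le_low {u : L2} (hu : u ∈ H) {d : Fin 2 → L2}
    (hd : ∀ i k j, coeff (d i) k j = Complex.I * k i * coeff u k j) {K : ℝ} (hK : 0 < K)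
    (hl : ∀ k j, lowSymbol K k * coeff u k j = coeff u k j) :
    ∀ᵐ x ∂cellMeasure, ‖u x‖ ≤ 8 * √(Real.log (Real.exp 1 + K)) * √(∑ i, ‖d i‖ ^ 2) := by
  have hL : 0 ≤ Real.log (Real.exp 1 + K) :=
    Real.log_nonneg (by linarith [Real.one_le_exp (zero_le_one' ℝ)])
  -- Split `|û_k| = |k|⁻¹ · |k||û_k|`: the squares of the first factors sum to a logarithm, those of
  -- the second to at most `‖u‖²`.
  have h := ae_norm_le_of_sum_le (u := u) (a := fun k => lowSymbol K k * (√(waveSq k))⁻¹)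
    (b := fun k j => √(waveSq k) * ‖coeff u k j‖) (A := 4 * √(Real.log (Real.exp 1 + K)))
    (B := √(∑ i, ‖d i‖ ^ 2)) (by positivity) (by positivity) ?_ ?_ ?_
  · filter_upwards [h] with x hx
    convert hx using 1; ring
  · intro k j
    rcases eq_or_ne k 0 with rfl | hk
    · simp [coeff_zero_of_mem_H hu]
    · have h1 : √(waveSq k) ≠ 0 := by
        have := Real.one_le_sqrt.2 (one_le_waveSq hk)
        positivity
      have h2 : ‖coeff u k j‖ = lowSymbol K k * ‖coeff u k j‖ := by
        conv_lhs => rw [← hl]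
        rw [norm_mul, Complex.norm_real, Real.norm_of_nonneg]
        rw [lowSymbol]; split_ifs <;> norm_num
      rw [mul_assoc, ← mul_assoc (√(waveSq k))⁻¹, inv_mul_cancel₀ h1, one_mul]
      exact h2.le
  · intro s
    calc ∑ k ∈ s, (lowSymbol K k * (√(waveSq k))⁻¹) ^ 2
        = ∑ k ∈ s, lowSymbol K k * (waveSq k)⁻¹ := by
          refine Finset.sum_congr rfl fun k _ => ?_
          rw [mul_pow, inv_pow, Real.sq_sqrt (waveSq_nonneg k), lowSymbol]; split_ifs <;> ring
      _ ≤ 16 * Real.log (Real.exp 1 + K) := sum_low_inv_waveSq_le K hK s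
      _ = _ := by rw [mul_pow, Real.sq_sqrt hL]; norm_num
  · intro s j
    rw [Real.sq_sqrt (Finset.sum_nonneg fun _ _ => sq_nonneg _)]
    calc ∑ k ∈ s, (√(waveSq k) * ‖coeff u k j‖) ^ 2
        = ∑ i, ∑ k ∈ s, ‖coeff (d i) k j‖ ^ 2 := by
          rw [Finset.sum_comm]
          refine Finset.sum_congr rfl fun k _ => ?_
          rw [norm_coeff_deriv_sq hd, mul_pow, Real.sq_sqrt (waveSq_nonneg k)]
      _ ≤ _ := Finset.sum_le_sum fun i _ => sum_norm_coeff_sq_le (d i) j s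

/-! ### The trilinear form -/

open Classical in
/-- The product `uᵢ f` (with the value `0` if it is not square-integrable). -/
def bmul (u : L2) (i : Fin 2) (f : L2) : L2 :=
  if h : MemLp (fun x => u x i • f x) 2 cellMeasure then h.toLp _ else 0

lemma abs_apply_le_norm (y : Plane) (i : Fin 2) : |y i| ≤ ‖y‖ := PiLp.norm_apply_le y i

lemma memLp_bmul {u : L2} {M : ℝ} (hu : ∀ᵐ x ∂cellMeasure, ‖u x‖ ≤ M) (i : Fin 2) (f : L2) :
    MemLp (fun x => u x i • f x) 2 cellMeasure := by
  refine MemLp.of_le_mul (c := M) (Lp.memLp f) ?_ ?_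
  · have h : AEStronglyMeasurable (fun x => u x i) cellMeasure :=
      (EuclideanSpace.proj i : Plane →L[ℝ] ℝ).continuous.comp_aestronglyMeasurable
        (Lp.aestronglyMeasurable u)
    exact h.smul (Lp.aestronglyMeasurable f)
  · filter_upwards [hu] with x hx
    rw [norm_smul]
    gcongr
    exact (abs_apply_le_norm _ _).trans hx

lemma coeFn_bmul {u : L2} {M : ℝ} (hu : ∀ᵐ x ∂cellMeasure, ‖u x‖ ≤ M) (i : Fin 2) (f : L2) :
    bmul u i f =ᵐ[cellMeasure] fun x => u x i • f x := by
  rw [bmul, dif_pos (memLp_bmul hu i f)]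
  exact MemLp.coeFn_toLp _

lemma norm_bmul_le {u : L2} {M : ℝ} (hu : ∀ᵐ x ∂cellMeasure, ‖u x‖ ≤ M) (i : Fin 2) (f : L2) :
    ‖bmul u i f‖ ≤ M * ‖f‖ := by
  refine Lp.norm_le_mul_norm_of_ae_le_mul ?_
  filter_upwards [hu, coeFn_bmul hu i f] with x hx h
  rw [h, norm_smul]
  gcongr
  exact (abs_apply_le_norm _ _).trans hx

/-- The sup bounds ensure that none of the products takes the default value of `bmul`, which would
destroy additivity. -/
lemma bmul_add_left {u v : L2} {M N : ℝ} (hu : ∀ᵐ x ∂cellMeasure, ‖u x‖ ≤ M)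
    (hv : ∀ᵐ x ∂cellMeasure, ‖v x‖ ≤ N) (i : Fin 2) (f : L2) :
    bmul (u + v) i f = bmul u i f + bmul v i f := by
  have huv : ∀ᵐ x ∂cellMeasure, ‖(u + v : L2) x‖ ≤ M + N := by
    filter_upwards [hu, hv, Lp.coeFn_add u v] with x h1 h2 h3
    rw [h3]; exact (norm_add_le _ _).trans (add_le_add h1 h2)
  refine Lp.ext ?_
  filter_upwards [coeFn_bmul hu i f, coeFn_bmul hv i f, coeFn_bmul huv i f, Lp.coeFn_add u v,
    Lp.coeFn_add (bmul u i f) (bmul v i f)] with x h1 h2 h3 h4 h5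
  rw [h5, Pi.add_apply, h1, h2, h3, h4, Pi.add_apply, PiLp.add_apply, add_smul]

lemma bmul_add_right {u : L2} {M : ℝ} (hu : ∀ᵐ x ∂cellMeasure, ‖u x‖ ≤ M) (i : Fin 2) (f g : L2) :
    bmul u i (f + g) = bmul u i f + bmul u i g := by
  refine Lp.ext ?_
  filter_upwards [coeFn_bmul hu i f, coeFn_bmul hu i g, coeFn_bmul hu i (f + g), Lp.coeFn_add f g,
    Lp.coeFn_add (bmul u i f) (bmul u i g)] with x h1 h2 h3 h4 h5
  rw [h5, Pi.add_apply, h1, h2, h3, h4, Pi.add_apply, smul_add]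

/-- The trilinear form `∫ (u · ∇) v · c`, where `d` are the derivatives of `v`. -/
def trilinear (u : L2) (d : Fin 2 → L2) (c : L2) : ℝ := ∑ i, inner ℝ (bmul u i (d i)) c

lemma abs_trilinear_le {u : L2} {M : ℝ} (hu : ∀ᵐ x ∂cellMeasure, ‖u x‖ ≤ M) (d : Fin 2 → L2)
    (c : L2) : |trilinear u d c| ≤ M * (∑ i, ‖d i‖) * ‖c‖ := by
  refine (Finset.abs_sum_le_sum_abs _ _).trans ?_
  rw [Finset.mul_sum, Finset.sum_mul]
  refine Finset.sum_le_sum fun i _ => (abs_real_inner_le_norm _ _).trans ?_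
  gcongr
  exact norm_bmul_le hu i (d i)

lemma trilinear_add_left {u v : L2} {M N : ℝ} (hu : ∀ᵐ x ∂cellMeasure, ‖u x‖ ≤ M)
    (hv : ∀ᵐ x ∂cellMeasure, ‖v x‖ ≤ N) (d : Fin 2 → L2) (c : L2) :
    trilinear (u + v) d c = trilinear u d c + trilinear v d c := by
  simp only [trilinear, bmul_add_left hu hv, inner_add_left, Finset.sum_add_distrib]

lemma trilinear_add_mid {u : L2} {M : ℝ} (hu : ∀ᵐ x ∂cellMeasure, ‖u x‖ ≤ M) (d e : Fin 2 → L2)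
    (c : L2) : trilinear u (fun i => d i + e i) c = trilinear u d c + trilinear u e c := by
  simp only [trilinear, bmul_add_right hu, inner_add_left, Finset.sum_add_distrib]

lemma trilinear_add_right (u : L2) (d : Fin 2 → L2) (c c' : L2) :
    trilinear u d (c + c') = trilinear u d c + trilinear u d c' := by
  simp only [trilinear, inner_add_right, Finset.sum_add_distrib]

/-! ### Enstrophy orthogonality in two dimensions -/

/-- The interaction coefficient of the wave vectors `k`, `l`, `m` in `∫ (u · ∇) u · A u`. -/
def triad (c : (Fin 2 → ℤ) → Fin 2 → ℂ) (k l m : Fin 2 → ℤ) : ℂ :=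
  ∑ i, ∑ j, c k i * (Complex.I * l i * c l j) * (waveSq m * c m j)

/-- In the plane, `k·a = 0` leaves only the direction `(-k₁, k₀)` when `k ≠ 0`. This is where
dimension two enters. -/
lemma exists_streamfunction {k : Fin 2 → ℤ} {a : Fin 2 → ℂ} (h0 : k = 0 → a = 0)
    (h : ∑ j, (k j : ℂ) * a j = 0) : ∃ ψ : ℂ, a 0 = -(k 1 : ℂ) * ψ ∧ a 1 = k 0 * ψ := by
  rw [Fin.sum_univ_two] at h
  by_cases hk : k 0 = 0
  · by_cases hk1 : k 1 = 0
    · have : k = 0 := by ext i; fin_cases i <;> simp [hk, hk1]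
      exact ⟨0, by simp [h0 this]⟩
    · have h1 : (k 1 : ℂ) ≠ 0 := by exact_mod_cast hk1
      rw [hk] at h ⊢
      have h2 : a 1 = 0 := by simpa [h1] using h
      refine ⟨-(a 0 / k 1), ?_, by simp [h2]⟩
      field_simp
  · have h1 : (k 0 : ℂ) ≠ 0 := by exact_mod_cast hk
    refine ⟨a 1 / k 0, ?_, by field_simp⟩
    field_simp
    linear_combination h

/-- The interactions within a triad of wave vectors cancel. -/
lemma triad_symm_sum {c : (Fin 2 → ℤ) → Fin 2 → ℂ} (h0 : ∀ j, c 0 j = 0)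
    (hdiv : ∀ k, ∑ j, (k j : ℂ) * c k j = 0) {k l m : Fin 2 → ℤ} (h : k + l + m = 0) :
    triad c k l m + triad c l k m + triad c l m k + triad c m l k + triad c m k l +
      triad c k m l = 0 := by
  obtain ⟨ψ, hk⟩ := exists_streamfunction (k := k) (a := c k)
    (fun e => by ext j; rw [e]; exact h0 j) (hdiv k)
  obtain ⟨χ, hl⟩ := exists_streamfunction (k := l) (a := c l)
    (fun e => by ext j; rw [e]; exact h0 j) (hdiv l)
  obtain ⟨ζ, hm⟩ := exists_streamfunction (k := m) (a := c m)
    (fun e => by ext j; rw [e]; exact h0 j) (hdiv m)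
  have hm0 : (m 0 : ℂ) = -(k 0 : ℂ) - l 0 := by
    have : m 0 = -k 0 - l 0 := by have := congrFun h 0; simp at this; omega
    rw [this]; push_cast; ring
  have hm1 : (m 1 : ℂ) = -(k 1 : ℂ) - l 1 := by
    have : m 1 = -k 1 - l 1 := by have := congrFun h 1; simp at this; omega
    rw [this]; push_cast; ring
  -- With stream functions inserted and `m = -k - l`, the sum is a polynomial in the components of
  -- `k` and `l` times the product of the three stream amplitudes, and it is identically zero.
  simp only [triad, waveSq, Fin.sum_univ_two, hk.1, hk.2, hl.1, hl.2, hm.1, hm.2]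
  push_cast
  rw [hm0, hm1]
  ring

/-- The resonance condition is symmetric, so averaging over the six permutations of `(k, l, m)`
reduces the claim to `triad_symm_sum`. -/
lemma sum_triad_eq_zero {c : (Fin 2 → ℤ) → Fin 2 → ℂ} (h0 : ∀ j, c 0 j = 0)
    (hdiv : ∀ k, ∑ j, (k j : ℂ) * c k j = 0) (S : Finset (Fin 2 → ℤ)) (z : ℂ) :
    ∑ k ∈ S, ∑ l ∈ S, ∑ m ∈ S, triad c k l m * (if k + l + m = 0 then z else 0) = 0 := by
  let G : (Fin 2 → ℤ) → (Fin 2 → ℤ) → (Fin 2 → ℤ) → ℂ := fun k l m =>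
    triad c k l m * (if k + l + m = 0 then z else 0)
  have hG : ∀ k l m, G k l m + G l k m + G l m k + G m l k + G m k l + G k m l = 0 := by
    intro k l m
    simp only [G]
    rw [show l + k + m = k + l + m by abel, show l + m + k = k + l + m by abel,
      show m + l + k = k + l + m by abel, show m + k + l = k + l + m by abel,
      show k + m + l = k + l + m by abel]
    split_ifs with h
    · rw [← add_mul, ← add_mul, ← add_mul, ← add_mul, ← add_mul, triad_symm_sum h0 hdiv h, zero_mul]
    · simp
  have e12 : ∀ G : (Fin 2 → ℤ) → (Fin 2 → ℤ) → (Fin 2 → ℤ) → ℂ,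
      ∑ k ∈ S, ∑ l ∈ S, ∑ m ∈ S, G l k m = ∑ k ∈ S, ∑ l ∈ S, ∑ m ∈ S, G k l m :=
    fun G => Finset.sum_comm
  have e23 : ∀ G : (Fin 2 → ℤ) → (Fin 2 → ℤ) → (Fin 2 → ℤ) → ℂ,
      ∑ k ∈ S, ∑ l ∈ S, ∑ m ∈ S, G k m l = ∑ k ∈ S, ∑ l ∈ S, ∑ m ∈ S, G k l m :=
    fun G => Finset.sum_congr rfl fun k _ => Finset.sum_comm
  have h2 := e12 G
  have h6 := e23 G
  have h3 := e23 fun k l m => G l k m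
  have h5 := e12 fun k l m => G k m l
  have h4 := e12 fun k l m => G l m k
  have hsum : ∑ k ∈ S, ∑ l ∈ S, ∑ m ∈ S,
      (G k l m + G l k m + G l m k + G m l k + G m k l + G k m l) = 0 :=
    Finset.sum_eq_zero fun k _ => Finset.sum_eq_zero fun l _ => Finset.sum_eq_zero fun m _ => hG k l m
  simp only [Finset.sum_add_distrib] at hsum
  have h7 := e12 fun k l m => G m k l
  have h8 := e23 fun k l m => G l m k
  have h9 := e23 fun k l m => G m l k
  change ∑ k ∈ S, ∑ l ∈ S, ∑ m ∈ S, G k l m = 0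
  have : 6 * ∑ k ∈ S, ∑ l ∈ S, ∑ m ∈ S, G k l m = 0 := by
    grind
  simpa using this

lemma ae_eq_sum_of_finite_support {u : L2} {S : Finset (Fin 2 → ℤ)}
    (h : ∀ k ∉ S, ∀ j, coeff u k j = 0) (j : Fin 2) :
    ∀ᵐ x ∂cellMeasure, ((u x j : ℝ) : ℂ) = ∑ k ∈ S, coeff u k j * wave k x := by
  have h2 : ((2 * Real.pi : ℝ) : ℂ) ≠ 0 := by simp [Real.pi_ne_zero]
  have h1 : component j u = ∑ k ∈ S, fourierBasis.repr (component j u) k • fourierBasis k := by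
    refine (fourierBasis.hasSum_repr (component j u)).unique (hasSum_sum_of_ne_finset_zero ?_)
    intro k hk
    have := h k hk j
    rw [coeff_eq_repr, mul_eq_zero] at this
    rw [this.resolve_left (inv_ne_zero h2), zero_smul]
  have h4 : ∀ᵐ x ∂cellMeasure, ∀ k : Fin 2 → ℤ,
      (fourierBasis.repr (component j u) k • fourierBasis k : ScalarL2) x =
        coeff u k j * wave k x := by
    rw [ae_all_iff]
    intro k
    filter_upwards [coeFn_waveLp k, Lp.coeFn_smul (fourierBasis.repr (component j u) k) (waveLp k)]
      with x hx hy
    have : fourierBasis k = waveLp k := by simp [fourierBasis]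
    rw [this, hy, Pi.smul_apply, hx, smul_eq_mul, coeff_eq_repr]
    ring
  filter_upwards [h4, coeFn_component j u,
    Lp.coeFn_finsetSum S fun k => fourierBasis.repr (component j u) k • fourierBasis k]
    with x hx hy hz
  rw [← hy, h1, hz, Finset.sum_apply]
  exact Finset.sum_congr rfl fun k _ => hx k

lemma integrable_mul_wave (c : ℂ) (k : Fin 2 → ℤ) :
    Integrable (fun x => c * wave k x) cellMeasure :=
  ((memLp_wave k).integrable (by norm_num)).const_mul c

lemma ofReal_trilinear {u : L2} {M : ℝ} (hu : ∀ᵐ x ∂cellMeasure, ‖u x‖ ≤ M) (d : Fin 2 → L2)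
    (c : L2) : ((trilinear u d c : ℝ) : ℂ) =
      ∫ x in cell, ∑ i, ∑ j, ((u x i : ℝ) : ℂ) * ((d i x j : ℝ) : ℂ) * ((c x j : ℝ) : ℂ) := by
  rw [trilinear]
  simp only [L2.inner_def]
  rw [← integral_finsetSum _ fun i _ => L2.integrable_inner _ _, ← integral_complex_ofReal]
  refine integral_congr_ae ?_
  filter_upwards [coeFn_bmul hu 0 (d 0), coeFn_bmul hu 1 (d 1)] with x h1 h2
  simp only [Fin.sum_univ_two, h1, h2, PiLp.inner_apply, PiLp.smul_apply, smul_eq_mul,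
    RCLike.inner_apply, conj_trivial]
  push_cast; ring

/-- For trigonometric polynomials the integral expands into a finite triple sum in which only triads
with `k + l + m = 0` survive. -/
lemma IsRegular.trilinear_eq_zero_of_finite_support {u w : L2} {d : Fin 2 → L2}
    (h : IsRegular u d w) {S : Finset (Fin 2 → ℤ)} (hS : ∀ k ∉ S, ∀ j, coeff u k j = 0) :
    trilinear u d w = 0 := by
  rw [← Complex.ofReal_eq_zero, ofReal_trilinear (ae_norm_le_stokes h.mem h.stokes)]
  have hd : ∀ i, ∀ k ∉ S, ∀ j, coeff (d i) k j = 0 := fun i k hk j => by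
    rw [h.deriv, hS k hk, mul_zero]
  have hw : ∀ k ∉ S, ∀ j, coeff w k j = 0 := fun k hk j => by rw [h.stokes, hS k hk, mul_zero]
  have hu' := ae_all_iff.2 fun j => ae_eq_sum_of_finite_support hS j
  have hd' := ae_all_iff.2 fun i => ae_all_iff.2 fun j => ae_eq_sum_of_finite_support (hd i) j
  have hw' := ae_all_iff.2 fun j => ae_eq_sum_of_finite_support hw j
  have e : ∫ x in cell, ∑ i, ∑ j, ((u x i : ℝ) : ℂ) * ((d i x j : ℝ) : ℂ) * ((w x j : ℝ) : ℂ) =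
      ∫ x in cell, ∑ k ∈ S, ∑ l ∈ S, ∑ m ∈ S, triad (coeff u) k l m * wave (k + l + m) x := by
    refine integral_congr_ae ?_
    filter_upwards [hu', hd', hw'] with x h1 h2 h3
    have h4 : ∀ i j, ((u x i : ℝ) : ℂ) * ((d i x j : ℝ) : ℂ) * ((w x j : ℝ) : ℂ) =
        ∑ k ∈ S, ∑ l ∈ S, ∑ m ∈ S, coeff u k i * (Complex.I * l i * coeff u l j) *
          (waveSq m * coeff u m j) * wave (k + l + m) x := by
      intro i j
      rw [h1, h2, h3, Finset.sum_mul_sum, Finset.sum_mul]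
      refine Finset.sum_congr rfl fun k _ => ?_
      rw [Finset.sum_mul]
      refine Finset.sum_congr rfl fun l _ => ?_
      rw [Finset.mul_sum]
      refine Finset.sum_congr rfl fun m _ => ?_
      rw [h.deriv, h.stokes, wave_add, wave_add]
      ring
    simp only [h4, triad, Fin.sum_univ_two, add_mul, Finset.sum_add_distrib]
  rw [e, integral_finsetSum]
  · simp_rw [integral_finsetSum S fun _ _ => integrable_finsetSum S fun _ _ => integrable_mul_wave _ _,
      integral_finsetSum S fun _ _ => integrable_mul_wave _ _, integral_const_mul, integral_wave]
    exact sum_triad_eq_zero (coeff_zero_of_mem_H h.mem) (divergence_coeff_of_mem_H h.mem) S _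
  · exact fun _ _ => integrable_finsetSum S fun _ _ => integrable_finsetSum S fun _ _ =>
      integrable_mul_wave _ _

lemma finite_lowSymbol_ne_zero (N : ℝ) : {k : Fin 2 → ℤ | lowSymbol N k ≠ 0}.Finite := by
  refine (Set.finite_Icc (fun _ => -⌈N⌉ : Fin 2 → ℤ) (fun _ => ⌈N⌉)).subset fun k hk => ?_
  have h1 : √(waveSq k) ≤ N := by
    by_contra h
    exact hk (by rw [lowSymbol, if_neg h])
  have h2 : ∀ i, |k i| ≤ ⌈N⌉ := by
    intro i
    have h3 : |(k i : ℝ)| ≤ √(waveSq k) := by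
      refine Real.abs_le_sqrt ?_
      exact Finset.single_le_sum (f := fun i => (k i : ℝ) ^ 2) (fun _ _ => sq_nonneg _)
        (Finset.mem_univ i)
    have h4 := (h3.trans h1).trans (Int.le_ceil N)
    exact_mod_cast h4
  exact ⟨fun i => (abs_le.1 (h2 i)).1, fun i => (abs_le.1 (h2 i)).2⟩

/-- The two-dimensional orthogonality `(B(u, u), A u) = 0`. -/
theorem IsRegular.trilinear_eq_zero {u w : L2} {d : Fin 2 → L2} (h : IsRegular u d w) :
    trilinear u d w = 0 := by
  have hM := ae_norm_le_stokes h.mem h.stokes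
  have hs : ∀ N : ℕ, IsSymbol (lowSymbol N) := fun N => isSymbol_lowSymbol N
  have hz : ∀ N : ℕ, trilinear (lowModes N u) (fun i => lowModes N (d i)) (lowModes N w) = 0 := by
    intro N
    refine (h.multiplier (hs N)).trilinear_eq_zero_of_finite_support
      (S := (finite_lowSymbol_ne_zero N).toFinset) fun k hk j => ?_
    rw [Set.Finite.mem_toFinset, Set.mem_ofPred_eq, not_not] at hk
    rw [coeff_multiplier (hs N), hk]; simp
  -- Replacing the three arguments by their truncations one at a time leaves three errors and the
  -- form of the truncated field, which is zero. The first error needs smallness in sup norm,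
  -- supplied by the high-mode estimate.
  have hbound : ∀ N : ℕ, 0 < N → |trilinear u d w| ≤
      12 / N * ‖w‖ * (∑ i, ‖d i‖) * ‖w‖ +
      24 * ‖w‖ * (∑ i, ‖d i - lowModes N (d i)‖) * ‖w‖ +
      24 * ‖w‖ * (∑ i, ‖d i‖) * ‖w - lowModes N w‖ := by
    intro N hN
    have hN' : (0 : ℝ) < N := by exact_mod_cast hN
    have hle : ∀ f, ‖lowModes N f‖ ≤ ‖f‖ := fun f => by
      have := norm_multiplier_le (hs N) (abs_lowSymbol_le N) f
      rwa [one_mul] at this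
    have hr := h.multiplier (hs N)
    have b1 : ∀ᵐ x ∂cellMeasure, ‖lowModes N u x‖ ≤ 24 * ‖w‖ := by
      filter_upwards [ae_norm_le_stokes hr.mem hr.stokes] with x hx
      exact hx.trans (by gcongr; exact hle w)
    have b2 : ∀ᵐ x ∂cellMeasure, ‖(u - lowModes N u : L2) x‖ ≤ 12 / N * ‖w‖ := by
      have hq : IsMultiplier waveSq (u - lowModes N u) (w - lowModes N w) := by
        intro k j
        rw [coeff_sub, coeff_sub, coeff_lowModes, coeff_lowModes, h.stokes]; ring
      have b3 := ae_norm_le_high hq hN' fun k j => ?_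
      · filter_upwards [b3] with x hx
        refine hx.trans ?_
        gcongr
        refine (norm_le_of_coeff_le (v := w) zero_le_one fun k j => ?_).trans_eq (one_mul _)
        rw [coeff_sub, coeff_lowModes, ← one_sub_mul, norm_mul]
        gcongr
        rw [← Complex.ofReal_one, ← Complex.ofReal_sub, Complex.norm_real]
        exact abs_one_sub_lowSymbol_le _ _
      · rw [coeff_sub, coeff_lowModes, lowSymbol]
        split_ifs <;> simp
    have e : trilinear u d w = trilinear (u - lowModes N u) d w +
        trilinear (lowModes N u) (fun i => d i - lowModes N (d i)) w +
        trilinear (lowModes N u) (fun i => lowModes N (d i)) (w - lowModes N w) := by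
      have e1 := trilinear_add_left b2 b1 d w
      have e2 := trilinear_add_mid b1 (fun i => d i - lowModes N (d i)) (fun i => lowModes N (d i)) w
      have e3 := trilinear_add_right (lowModes N u) (fun i => lowModes N (d i)) (w - lowModes N w)
        (lowModes N w)
      simp only [sub_add_cancel] at e1 e2 e3
      rw [e1, e2, e3, hz N]; ring
    rw [e]
    refine (abs_add_three _ _ _).trans (add_le_add (add_le_add ?_ ?_) ?_)
    · exact abs_trilinear_le b2 _ _
    · exact abs_trilinear_le b1 _ _
    · refine (abs_trilinear_le b1 _ _).trans ?_
      gcongr with i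
      exact hle _
  have hlim : Tendsto (fun N : ℕ => 12 / (N : ℝ) * ‖w‖ * (∑ i, ‖d i‖) * ‖w‖ +
      24 * ‖w‖ * (∑ i, ‖d i - lowModes N (d i)‖) * ‖w‖ +
      24 * ‖w‖ * (∑ i, ‖d i‖) * ‖w - lowModes N w‖) atTop (𝓝 0) := by
    have t1 : Tendsto (fun N : ℕ => 12 / (N : ℝ)) atTop (𝓝 0) :=
      tendsto_const_nhds.div_atTop tendsto_natCast_atTop_atTop
    have t2 : ∀ f, Tendsto (fun N : ℕ => ‖f - lowModes N f‖) atTop (𝓝 0) := fun f => by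
      have := ((tendsto_const_nhds (x := f)).sub (tendsto_lowModes f)).norm
      simpa using this
    have t3 := tendsto_finsetSum Finset.univ fun i _ => t2 (d i)
    have := ((((t1.mul_const ‖w‖).mul_const (∑ i, ‖d i‖)).mul_const ‖w‖).add
      ((t3.const_mul (24 * ‖w‖)).mul_const ‖w‖)).add ((t2 w).const_mul (24 * ‖w‖ * (∑ i, ‖d i‖)))
    simpa using this
  have := ge_of_tendsto hlim ((eventually_gt_atTop 0).mono hbound)
  exact abs_nonpos_iff.1 this

/-! ### Energy identity for bounded symmetric operators -/

lemma absolutelyContinuousOnInterval_of_dist_le {X Y : Type*} [PseudoMetricSpace X]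
    [PseudoMetricSpace Y] {g : ℝ → X} {Φ : ℝ → Y} {a b C : ℝ}
    (hΦ : AbsolutelyContinuousOnInterval Φ a b)
    (h : ∀ s ∈ Set.uIcc a b, ∀ t ∈ Set.uIcc a b, dist (g s) (g t) ≤ C * dist (Φ s) (Φ t)) :
    AbsolutelyContinuousOnInterval g a b := by
  have h1 := Tendsto.const_mul C hΦ
  rw [mul_zero] at h1
  refine squeeze_zero' (Eventually.of_forall fun E => Finset.sum_nonneg fun _ _ => dist_nonneg) ?_ h1
  have h2 : ∀ᶠ E in AbsolutelyContinuousOnInterval.totalLengthFilter ⊓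
      𝓟 (AbsolutelyContinuousOnInterval.disjWithin a b),
      E ∈ AbsolutelyContinuousOnInterval.disjWithin a b :=
    eventually_inf_principal.2 (Eventually.of_forall fun _ h => h)
  filter_upwards [h2] with E hE
  rw [Finset.mul_sum]
  exact Finset.sum_le_sum fun i hi => h _ (hE.1 i hi).1 _ (hE.1 i hi).2

/-- The energy identity for the quadratic form of a bounded symmetric operator along an
absolutely continuous path. -/
theorem inner_apply_sub_eq_integral {X : Type*} [NormedAddCommGroup X] [InnerProductSpace ℝ X]
    [CompleteSpace X] {T : X →L[ℝ] X} (hT : ∀ x y, inner ℝ (T x) y = inner ℝ x (T y))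
    {f : ℝ → X} {a b : ℝ} (hab : a ≤ b) (hf : IntervalIntegrable f volume a b) {u : ℝ → X}
    (hu : ∀ t ∈ Set.Icc a b, u t = u a + ∫ s in a..t, f s) :
    inner ℝ (u b) (T (u b)) - inner ℝ (u a) (T (u a)) = ∫ s in a..b, 2 * inner ℝ (f s) (T (u s)) := by
  -- `u` is given by the integral formula only on `[a, b]`; this extension has two-sided derivative
  -- `f` at almost every point of the interval.
  let U : ℝ → X := fun t => u a + ∫ s in a..t, f s
  have hUc : ContinuousOn U (Set.uIcc a b) :=
    continuousOn_const.add (intervalIntegral.continuousOn_primitive_interval' hf Set.left_mem_uIcc)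
  obtain ⟨C, hC⟩ := isCompact_uIcc.exists_bound_of_continuousOn hUc
  have hsub : ∀ s ∈ Set.uIcc a b, ∀ t ∈ Set.uIcc a b, U s - U t = ∫ r in t..s, f r := by
    intro s hs t ht
    have h1 := hf.mono_set (Set.uIcc_subset_uIcc Set.left_mem_uIcc hs)
    have h2 := hf.mono_set (Set.uIcc_subset_uIcc Set.left_mem_uIcc ht)
    simp only [U, add_sub_add_left_eq_sub]
    exact intervalIntegral.integral_interval_sub_left h1 h2
  have hE : ∀ s t, inner ℝ (U s) (T (U s)) - inner ℝ (U t) (T (U t)) =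
      inner ℝ (U s - U t) (T (U s + U t)) := by
    intro s t
    have h1 : inner ℝ (U t) (T (U s)) = inner ℝ (U s) (T (U t)) := by
      rw [← hT, real_inner_comm]
    generalize U s = x at h1 ⊢
    generalize U t = y at h1 ⊢
    rw [map_add, inner_sub_left, inner_add_right, inner_add_right, h1]
    ring
  -- By symmetry of `T`, increments of the quadratic form are `(U s - U t, T(U s + U t))`, hence
  -- bounded by a constant times increments of the primitive of `‖f‖`.
  have hac : AbsolutelyContinuousOnInterval (fun t => inner ℝ (U t) (T (U t))) a b := by
    have hΦ := hf.norm.absolutelyContinuousOnInterval_intervalIntegral (c := a) Set.left_mem_uIcc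
    refine absolutelyContinuousOnInterval_of_dist_le (C := ‖T‖ * (C + C)) hΦ fun s hs t ht => ?_
    have h1 := hf.mono_set (Set.uIcc_subset_uIcc Set.left_mem_uIcc hs)
    have h2 := hf.mono_set (Set.uIcc_subset_uIcc Set.left_mem_uIcc ht)
    rw [Real.dist_eq, Real.dist_eq, hE,
      intervalIntegral.integral_interval_sub_left h1.norm h2.norm, hsub s hs t ht]
    refine (abs_real_inner_le_norm _ _).trans ?_
    rw [mul_comm]
    refine mul_le_mul ?_ (intervalIntegral.norm_integral_le_abs_integral_norm) (norm_nonneg _) ?_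
    · refine (T.le_opNorm _).trans ?_
      gcongr
      exact (norm_add_le _ _).trans (add_le_add (hC s hs) (hC t ht))
    · have := (norm_nonneg _).trans (hC s hs)
      positivity
  have hi : IntervalIntegrable (fun s => 2 * inner ℝ (f s) (T (U s))) volume a b := by
    refine IntervalIntegrable.const_mul ?_ 2
    have hTU : ContinuousOn (fun s => T (U s)) (Set.uIcc a b) := T.continuous.comp_continuousOn hUc
    refine (hf.norm.mul_const (‖T‖ * C)).mono_fun ?_ ?_
    · refine AEStronglyMeasurable.inner hf.def'.aestronglyMeasurable ?_
      exact (hTU.mono Set.uIoc_subset_uIcc).aestronglyMeasurable measurableSet_uIoc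
    · filter_upwards [ae_restrict_mem measurableSet_uIoc] with s hs
      have h0 := (norm_nonneg _).trans (hC s (Set.uIoc_subset_uIcc hs))
      rw [norm_mul, norm_norm, Real.norm_of_nonneg (mul_nonneg (norm_nonneg T) h0)]
      refine (norm_inner_le_norm _ _).trans ?_
      gcongr
      exact (T.le_opNorm _).trans (by gcongr; exact hC s (Set.uIoc_subset_uIcc hs))
  have hac2 := hac.sub (hi.absolutelyContinuousOnInterval_intervalIntegral (c := a) Set.left_mem_uIcc)
  -- The difference of the two sides is absolutely continuous with derivative zero almost
  -- everywhere, hence constant.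
  obtain ⟨D, hD⟩ := hac2.const_of_ae_hasDerivAt_zero (by
    filter_upwards [hf.ae_hasDerivAt_integral, hi.ae_hasDerivAt_integral] with x h1 h2 hx
    have h3 : HasDerivAt U (f x) x := (h1 hx a Set.left_mem_uIcc).const_add _
    have h4 : HasDerivAt (fun t => T (U t)) (T (f x)) x := T.hasFDerivAt.comp_hasDerivAt x h3
    have h5 := (h3.inner ℝ h4).sub (h2 hx a Set.left_mem_uIcc)
    have h6 : inner ℝ (U x) (T (f x)) = inner ℝ (f x) (T (U x)) := by
      rw [← hT, real_inner_comm]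
    convert! h5 using 1
    rw [h6]; ring)
  have h6 := (hD b Set.right_mem_uIcc).trans (hD a Set.left_mem_uIcc).symm
  have hUu : ∀ t ∈ Set.Icc a b, U t = u t := fun t ht => (hu t ht).symm
  simp only [Pi.sub_apply, intervalIntegral.integral_same, sub_zero] at h6
  rw [hUu a ⟨le_rfl, hab⟩, hUu b ⟨hab, le_rfl⟩] at h6
  have h7 : ∫ s in a..b, 2 * inner ℝ (f s) (T (U s)) = ∫ s in a..b, 2 * inner ℝ (f s) (T (u s)) := by
    refine intervalIntegral.integral_congr fun s hs => ?_
    simp only [hUu s (Set.uIcc_of_le hab ▸ hs)]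
  linarith

/-! ### Enstrophy identity for strong paths -/

/-- The squared `V`-norm of the part of a field singled out by the symbol `χ`. -/
def enstrophy (χ : (Fin 2 → ℤ) → ℝ) (u : L2) : ℝ := ∑ j, ‖multiplier χ (weakDeriv j u)‖ ^ 2

lemma lowSymbol_mul_self (N : ℝ) (k : Fin 2 → ℤ) : lowSymbol N k * lowSymbol N k = lowSymbol N k := by
  rw [lowSymbol]; split_ifs <;> simp

lemma isSymbol_energy {χ : (Fin 2 → ℤ) → ℝ} (hχ : IsSymbol χ) (N : ℝ) :
    IsSymbol fun k => lowSymbol N k * waveSq k * (χ k * χ k) :=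
  (isSymbol_lowWaveSq N).mul (hχ.mul hχ)

/-- The cutoff at `N` makes `χ A χ` a bounded symmetric operator, to which
`inner_apply_sub_eq_integral` applies; its quadratic form is a truncated enstrophy. -/
lemma inner_multiplier_energy {χ : (Fin 2 → ℤ) → ℝ} (hχ : IsSymbol χ) (N : ℝ) {u : L2}
    (hu : MemV u) :
    inner ℝ u (multiplier (fun k => lowSymbol N k * waveSq k * (χ k * χ k)) u) =
      ∑ j, ‖lowModes N (multiplier χ (weakDeriv j u))‖ ^ 2 := by
  refine (hasSum_inner _ _).unique ?_
  convert! hasSum_sum fun j (_ : j ∈ Finset.univ) =>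
    hasSum_norm_sq (lowModes N (multiplier χ (weakDeriv j u))) using 2 with k
  rw [← Finset.mul_sum, Finset.sum_comm]
  congr 1
  refine Finset.sum_congr rfl fun i _ => ?_
  have h1 : ∀ j, ‖coeff (lowModes N (multiplier χ (weakDeriv j u))) k i‖ ^ 2 =
      lowSymbol N k * (χ k * χ k) * ‖coeff (weakDeriv j u) k i‖ ^ 2 := by
    intro j
    rw [coeff_lowModes, coeff_multiplier hχ, norm_mul, norm_mul, Complex.norm_real,
      Complex.norm_real, mul_pow, mul_pow, Real.norm_eq_abs, Real.norm_eq_abs, sq_abs, sq_abs, sq,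
      lowSymbol_mul_self, sq (χ k)]
    ring
  rw [Finset.sum_congr rfl fun j _ => h1 j, ← Finset.mul_sum,
    norm_coeff_deriv_sq fun i k j => coeff_weakDeriv hu i k j, coeff_multiplier (isSymbol_energy hχ N),
    mul_left_comm, ← Complex.normSq_eq_conj_mul_self, ← Complex.ofReal_mul, Complex.ofReal_re,
    Complex.normSq_eq_norm_sq]
  ring

lemma MemDA.isMultiplier {u : L2} (h : MemDA u) : IsMultiplier waveSq u (stokes u) := by
  obtain ⟨f, hf⟩ := h.2
  exact hf.multiplier

lemma multiplier_energy_eq {χ : (Fin 2 → ℤ) → ℝ} (hχ : IsSymbol χ) (N : ℝ) {u : L2}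
    (hu : MemDA u) :
    multiplier (fun k => lowSymbol N k * waveSq k * (χ k * χ k)) u =
      multiplier χ (lowModes N (multiplier χ (stokes u))) := by
  refine ext_coeff fun k j => ?_
  rw [coeff_multiplier (isSymbol_energy hχ N), coeff_multiplier hχ, coeff_lowModes,
    coeff_multiplier hχ, hu.isMultiplier]
  push_cast; ring

lemma norm_multiplier_le_self {χ : (Fin 2 → ℤ) → ℝ} (hχ : IsSymbol χ) (h1 : ∀ k, |χ k| ≤ 1)
    (u : L2) : ‖multiplier χ u‖ ≤ ‖u‖ :=
  (norm_multiplier_le hχ h1 u).trans_eq (one_mul _)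

lemma norm_lowModes_le (N : ℝ) (u : L2) : ‖lowModes N u‖ ≤ ‖u‖ :=
  norm_multiplier_le_self (isSymbol_lowSymbol N) (abs_lowSymbol_le N) u

/-- The enstrophy identity for the part of a strong path singled out by a symbol. -/
theorem enstrophy_sub_eq_integral {u f : ℝ → L2} (hu : IsStrongPath u)
    (hf : ∀ t, 0 ≤ t → IntervalIntegrable f volume 0 t)
    (he : ∀ t, 0 ≤ t → u t = u 0 + ∫ s in (0 : ℝ)..t, f s)
    (hb : ∀ T, 0 < T → ∃ c, ∀ᵐ s ∂(volume.restrict (Set.Ioc 0 T)), ‖f s‖ ≤ c * (1 + ‖stokes (u s)‖))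
    {χ : (Fin 2 → ℤ) → ℝ} (hχ : IsSymbol χ) (h1 : ∀ k, |χ k| ≤ 1) {s t : ℝ} (hs : 0 ≤ s)
    (hst : s ≤ t) :
    IntervalIntegrable (fun r => 2 * inner ℝ (multiplier χ (f r)) (multiplier χ (stokes (u r))))
      volume s t ∧
    enstrophy χ (u t) - enstrophy χ (u s) =
      ∫ r in s..t, 2 * inner ℝ (multiplier χ (f r)) (multiplier χ (stokes (u r))) := by
  have ht := hs.trans hst
  have hfi : IntervalIntegrable f volume s t := (hf s hs).symm.trans (hf t ht)
  -- The hypotheses require a positive final time, and `t` may be zero.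
  obtain ⟨c, hc⟩ := hb (t + 1) (by linarith)
  have hsub : Set.uIoc s t ⊆ Set.Ioc 0 (t + 1) := by
    rw [Set.uIoc_of_le hst]; exact Set.Ioc_subset_Ioc hs (by linarith)
  have hsub' : Set.uIoc s t ⊆ Set.Ioi 0 := hsub.trans Set.Ioc_subset_Ioi_self
  have hc' := ae_restrict_of_ae_restrict_of_subset hsub hc
  have hDA := ae_restrict_of_ae_restrict_of_subset hsub' hu.memDA
  have hst2 : MemLp (fun r => stokes (u r)) 2 (volume.restrict (Set.uIoc s t)) :=
    (hu.stokes_memLp (t + 1) (by linarith)).mono_measure (Measure.restrict_mono hsub le_rfl)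
  have : IsFiniteMeasure (volume.restrict (Set.uIoc s t)) := by
    rw [Set.uIoc_of_le hst]; infer_instance
  have hfm := hfi.def'.aestronglyMeasurable
  -- A dominating function independent of the cutoff: `‖f‖ ≤ c(1 + |Au|)` makes the product at most
  -- `|c|(1 + 2|Au|²)`, integrable since `Au` is square-integrable in time.
  have hbi : IntervalIntegrable (fun r => 2 * (‖f r‖ * ‖stokes (u r)‖)) volume s t := by
    refine IntervalIntegrable.const_mul ?_ 2
    rw [intervalIntegrable_iff]
    have h2 : Integrable (fun r => ‖stokes (u r)‖ ^ 2) (volume.restrict (Set.uIoc s t)) :=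
      hst2.integrable_norm_pow (by norm_num)
    have h3 : Integrable (fun r => |c| * (1 + 2 * ‖stokes (u r)‖ ^ 2))
        (volume.restrict (Set.uIoc s t)) :=
      ((integrable_const 1).add (h2.const_mul 2)).const_mul _
    refine h3.mono' (hfm.norm.mul hst2.aestronglyMeasurable.norm) ?_
    filter_upwards [hc'] with r hr
    rw [norm_mul, norm_norm, norm_norm]
    calc ‖f r‖ * ‖stokes (u r)‖ ≤ (|c| * (1 + ‖stokes (u r)‖)) * ‖stokes (u r)‖ := by
          gcongr
          exact hr.trans (by gcongr; exact le_abs_self c)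
      _ ≤ |c| * (1 + 2 * ‖stokes (u r)‖ ^ 2) := by
          rw [mul_assoc]
          gcongr
          nlinarith [sq_nonneg (‖stokes (u r)‖ - 1)]
  have hmeas : AEStronglyMeasurable
      (fun r => 2 * inner ℝ (multiplier χ (f r)) (multiplier χ (stokes (u r))))
      (volume.restrict (Set.uIoc s t)) :=
    (((multiplierL hχ).continuous.comp_aestronglyMeasurable hfm).inner
      ((multiplierL hχ).continuous.comp_aestronglyMeasurable hst2.aestronglyMeasurable)).const_mul 2
  refine ⟨?_, ?_⟩
  · refine hbi.mono_fun hmeas (Eventually.of_forall fun r => ?_)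
    simp only [Real.norm_ofNat, norm_mul, norm_norm]
    gcongr
    refine (norm_inner_le_norm _ _).trans ?_
    gcongr <;> exact norm_multiplier_le_self hχ h1 _
  · have hid : ∀ N : ℕ,
        ∑ j, ‖lowModes N (multiplier χ (weakDeriv j (u t)))‖ ^ 2 -
          ∑ j, ‖lowModes N (multiplier χ (weakDeriv j (u s)))‖ ^ 2 =
        ∫ r in s..t, 2 * inner ℝ (f r)
          (multiplier (fun k => lowSymbol N k * waveSq k * (χ k * χ k)) (u r)) := by
      intro N
      rw [← inner_multiplier_energy hχ N (hu.memV t ht), ← inner_multiplier_energy hχ N (hu.memV s hs)]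
      refine inner_apply_sub_eq_integral (T := multiplierL (isSymbol_energy hχ N))
        (inner_multiplier (isSymbol_energy hχ N)) hst hfi fun r hr => ?_
      have hr0 := hs.trans hr.1
      rw [he r hr0, he s hs, add_assoc,
        intervalIntegral.integral_add_adjacent_intervals (hf s hs)
          ((hf s hs).symm.trans (hf r hr0))]
    have hlim1 : ∀ r, Tendsto (fun N : ℕ => ∑ j, ‖lowModes N (multiplier χ (weakDeriv j (u r)))‖ ^ 2)
        atTop (𝓝 (enstrophy χ (u r))) := fun r =>
      tendsto_finsetSum _ fun j _ => ((tendsto_lowModes _).norm).pow 2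
    have hlim2 : Tendsto (fun N : ℕ => ∫ r in s..t, 2 * inner ℝ (f r)
          (multiplier (fun k => lowSymbol N k * waveSq k * (χ k * χ k)) (u r))) atTop
        (𝓝 (∫ r in s..t, 2 * inner ℝ (multiplier χ (f r)) (multiplier χ (stokes (u r))))) := by
      have hconv : ∀ᵐ r ∂(volume.restrict (Set.uIoc s t)), ∀ N : ℕ, inner ℝ (f r)
          (multiplier (fun k => lowSymbol N k * waveSq k * (χ k * χ k)) (u r)) =
          inner ℝ (multiplier χ (f r)) (lowModes N (multiplier χ (stokes (u r)))) := by
        filter_upwards [hDA] with r hr N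
        rw [multiplier_energy_eq hχ N hr, inner_multiplier hχ]
      refine intervalIntegral.tendsto_integral_filter_of_dominated_convergence _
        (Eventually.of_forall fun N => ?_) (Eventually.of_forall fun N => ?_) hbi ?_
      · have h4 : AEStronglyMeasurable (fun r => 2 * inner ℝ (multiplier χ (f r))
            (lowModes N (multiplier χ (stokes (u r))))) (volume.restrict (Set.uIoc s t)) :=
          (((multiplierL hχ).continuous.comp_aestronglyMeasurable hfm).inner
            (((multiplierL (isSymbol_lowSymbol N)).continuous.comp
              (multiplierL hχ).continuous).comp_aestronglyMeasurable
                hst2.aestronglyMeasurable)).const_mul 2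
        refine h4.congr ?_
        filter_upwards [hconv] with r hr
        rw [hr]
      · rw [← ae_restrict_iff' measurableSet_uIoc]
        filter_upwards [hconv] with r hr
        rw [hr, norm_mul, Real.norm_ofNat]
        gcongr
        refine (norm_inner_le_norm _ _).trans ?_
        gcongr
        · exact norm_multiplier_le_self hχ h1 _
        · exact (norm_lowModes_le _ _).trans (norm_multiplier_le_self hχ h1 _)
      · rw [← ae_restrict_iff' measurableSet_uIoc]
        filter_upwards [hconv] with r hr
        simp only [hr]
        exact (tendsto_const_nhds.inner (tendsto_lowModes _)).const_mul 2
    refine tendsto_nhds_unique ((hlim1 t).sub (hlim1 s)) ?_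
    simp only [hid]
    exact hlim2

/-! ### Grönwall's lemma -/

/-- A Grönwall lemma for integral inequalities. -/
lemma eventually_le_of_sub_le_integral {y : ℝ → ℝ} {t₀ a b B : ℝ} (hy : ContinuousOn y (Set.Ici t₀))
    (ha : 0 < a) (hB : b / a < B)
    (h : ∀ s t, t₀ ≤ s → s ≤ t → y t - y s ≤ ∫ r in s..t, (b - a * y r)) :
    ∀ᶠ t in atTop, y t ≤ B := by
  have hg : ∀ t, t₀ ≤ t → y t ≤ gronwallBound (y t₀) (-a) b (t - t₀) := by
    intro t ht
    refine le_gronwallBound_of_liminf_deriv_right_le (f' := fun x => b - a * y x)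
      (hy.mono Set.Icc_subset_Ici_self) ?_ le_rfl (fun x _ => by linarith) t ⟨ht, le_rfl⟩
    intro x hx r hr
    obtain ⟨r', hr1, hr2⟩ := exists_between hr
    have hcx : ContinuousWithinAt (fun z => b - a * y z) (Set.Ici x) x :=
      (continuousWithinAt_const.sub (continuousWithinAt_const.mul
        ((hy x hx.1).mono (Set.Ici_subset_Ici.2 hx.1))))
    have hev := hcx.eventually_lt_const hr1
    rw [eventually_nhdsWithin_iff, Metric.eventually_nhds_iff] at hev
    obtain ⟨δ, hδ, hev⟩ := hev
    -- `y` need not be differentiable: its right difference quotient is at most the mean of `b - a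
    -- y` over `[x, z]`, which continuity keeps below `r' < r`.
    refine Eventually.frequently ?_
    filter_upwards [Ioo_mem_nhdsGT (show x < x + δ by linarith)] with z hz
    have h1 : ∫ r in x..z, (b - a * y r) ≤ ∫ _ in x..z, r' := by
      refine intervalIntegral.integral_mono_on hz.1.le ?_ intervalIntegrable_const fun w hw => ?_
      · refine ContinuousOn.intervalIntegrable ?_
        rw [Set.uIcc_of_le hz.1.le]
        exact continuousOn_const.sub (continuousOn_const.mul
          (hy.mono fun w hw => hx.1.trans hw.1))
      · refine (hev ?_ hw.1).le
        rw [Real.dist_eq, abs_of_nonneg (by linarith [hw.1])]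
        linarith [hw.2, hz.2]
    rw [intervalIntegral.integral_const, smul_eq_mul] at h1
    have h2 := h x z hx.1 hz.1.le
    have h3 : 0 < z - x := sub_pos.2 hz.1
    rw [inv_mul_lt_iff₀ h3]
    nlinarith
  have hlim : Tendsto (fun t => gronwallBound (y t₀) (-a) b (t - t₀)) atTop (𝓝 (b / a)) := by
    rw [gronwallBound_of_K_ne_0 (neg_ne_zero.2 ha.ne')]
    have h1 : Tendsto (fun t => Real.exp (-a * (t - t₀))) atTop (𝓝 0) := by
      refine Real.tendsto_exp_atBot.comp ?_
      exact (tendsto_atTop_add_const_right _ (-t₀) tendsto_id).const_mul_atTop_of_neg (neg_lt_zero.2 ha)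
    have h2 := (h1.const_mul (y t₀)).add ((h1.sub_const 1).const_mul (b / -a))
    convert! h2 using 2
    field_simp; ring
  filter_upwards [hlim.eventually_le_const hB, eventually_ge_atTop t₀] with t h1 h2
  exact (hg t h2).trans h1

/-! ### The nonlinearity and Poincaré inequalities -/

lemma isRegular_of_memDA {u : L2} (hV : MemV u) (hA : MemDA u) :
    IsRegular u (fun i => weakDeriv i u) (stokes u) where
  mem := hV.1
  deriv i k j := coeff_weakDeriv hV i k j
  stokes := hA.isMultiplier

lemma advection_ae_eq {u : L2} {M : ℝ} (hu : ∀ᵐ x ∂cellMeasure, ‖u x‖ ≤ M) :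
    advection u u =ᵐ[cellMeasure] (∑ i, bmul u i (weakDeriv i u) : L2) := by
  filter_upwards [coeFn_bmul hu 0 (weakDeriv 0 u), coeFn_bmul hu 1 (weakDeriv 1 u),
    Lp.coeFn_finsetSum Finset.univ fun i => bmul u i (weakDeriv i u)] with x h1 h2 h3
  rw [h3, Finset.sum_apply, advection, Fin.sum_univ_two, Fin.sum_univ_two, h1, h2]

lemma B_eq_leray {u : L2} {M : ℝ} (hu : ∀ᵐ x ∂cellMeasure, ‖u x‖ ≤ M) :
    B u u = leray (∑ i, bmul u i (weakDeriv i u)) := by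
  have h := advection_ae_eq hu
  have hm : MemLp (advection u u) 2 cellMeasure := (memLp_congr_ae h).2 (Lp.memLp _)
  rw [B, dif_pos hm]
  congr 1
  exact Lp.ext (hm.coeFn_toLp.trans h)

lemma inner_B {u : L2} {M : ℝ} (hu : ∀ᵐ x ∂cellMeasure, ‖u x‖ ≤ M) {c : L2} (hc : c ∈ H) :
    inner ℝ (B u u) c = trilinear u (fun i => weakDeriv i u) c := by
  rw [B_eq_leray hu, inner_leray hc, sum_inner, trilinear]

lemma norm_B_le {u : L2} {M : ℝ} (hu : ∀ᵐ x ∂cellMeasure, ‖u x‖ ≤ M) :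
    ‖B u u‖ ≤ M * ∑ i, ‖weakDeriv i u‖ := by
  rw [B_eq_leray hu, Finset.mul_sum]
  exact (norm_leray_le _).trans (norm_sum_le_of_le _ fun i _ => norm_bmul_le hu i _)

/-- The Poincaré inequality for fields whose Fourier modes satisfy `|k|² ≥ c`. -/
lemma IsRegular.mul_sum_norm_sq_le {u w : L2} {d : Fin 2 → L2} (h : IsRegular u d w) {c : ℝ}
    (hc : ∀ k, (∀ j, coeff u k j = 0) ∨ c ≤ waveSq k) : c * ∑ i, ‖d i‖ ^ 2 ≤ ‖w‖ ^ 2 := by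
  have h1 := (hasSum_sum fun i (_ : i ∈ Finset.univ) => hasSum_norm_sq (d i)).mul_left c
  refine hasSum_le (fun k => ?_) h1 (hasSum_norm_sq w)
  rw [← Finset.mul_sum, Finset.sum_comm, mul_left_comm]
  refine mul_le_mul_of_nonneg_left ?_ (by positivity)
  rw [Finset.mul_sum]
  refine Finset.sum_le_sum fun j _ => ?_
  rw [norm_coeff_deriv_sq h.deriv, h.stokes, norm_mul, Complex.norm_real, mul_pow,
    Real.norm_eq_abs, sq_abs, ← mul_assoc]
  rcases hc k with h0 | h0
  · simp [h0 j]
  · have := waveSq_nonneg k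
    rw [sq (waveSq k)]
    gcongr

lemma IsRegular.sum_norm_sq_le {u w : L2} {d : Fin 2 → L2} (h : IsRegular u d w) :
    ∑ i, ‖d i‖ ^ 2 ≤ ‖w‖ ^ 2 := by
  refine (one_mul _).symm.trans_le (h.mul_sum_norm_sq_le fun k => ?_)
  rcases eq_or_ne k 0 with rfl | hk
  · exact Or.inl (coeff_zero_of_mem_H h.mem)
  · exact Or.inr (one_le_waveSq hk)

lemma enstrophy_le {χ : (Fin 2 → ℤ) → ℝ} (hχ : IsSymbol χ) {u : L2} (hV : MemV u) (hA : MemDA u) :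
    enstrophy χ u ≤ ‖multiplier χ (stokes u)‖ ^ 2 :=
  ((isRegular_of_memDA hV hA).multiplier hχ).sum_norm_sq_le

lemma mul_enstrophy_high_le {K : ℝ} (hK : 0 < K) {u : L2} (hV : MemV u) (hA : MemDA u) :
    K ^ 2 * enstrophy (fun k => 1 - lowSymbol K k) u ≤
      ‖multiplier (fun k => 1 - lowSymbol K k) (stokes u)‖ ^ 2 := by
  refine ((isRegular_of_memDA hV hA).multiplier (isSymbol_highSymbol K)).mul_sum_norm_sq_le
    fun k => ?_
  by_cases hk : √(waveSq k) ≤ K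
  · refine Or.inl fun j => ?_
    rw [coeff_multiplier (isSymbol_highSymbol K), lowSymbol, if_pos hk]; simp
  · exact Or.inr ((Real.lt_sqrt hK.le).1 (not_le.1 hk)).le

/-! ### Differential inequalities for the low and high modes -/

/-- The right-hand side of the evolution equation with the low modes of the nonlinearity removed. -/
def drift (ν K : ℝ) (g u : L2) : L2 := g - ν • stokes u - (B u u - lowModes K (B u u))

/-- `P_K(1 - P_K) = 0` removes the nonlinearity, so the low modes evolve linearly. -/
lemma multiplier_low_drift (ν K : ℝ) (g u : L2) :
    multiplier (lowSymbol K) (drift ν K g u) =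
      multiplier (lowSymbol K) g - ν • multiplier (lowSymbol K) (stokes u) := by
  have h := isSymbol_lowSymbol K
  refine ext_coeff fun k j => ?_
  simp only [drift, coeff_multiplier h, coeff_sub, coeff_smul, coeff_lowModes]
  have h2 : (lowSymbol K k : ℂ) * lowSymbol K k = lowSymbol K k := by
    exact_mod_cast congrArg (fun r : ℝ => (r : ℂ)) (lowSymbol_mul_self K k)
  linear_combination (coeff (B u u) k j) * h2

lemma multiplier_high_drift (ν K : ℝ) (g u : L2) :
    multiplier (fun k => 1 - lowSymbol K k) (drift ν K g u) =
      multiplier (fun k => 1 - lowSymbol K k) g -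
        ν • multiplier (fun k => 1 - lowSymbol K k) (stokes u) -
        multiplier (fun k => 1 - lowSymbol K k) (B u u) := by
  have h := isSymbol_highSymbol K
  refine ext_coeff fun k j => ?_
  simp only [drift, coeff_multiplier h, coeff_sub, coeff_smul, coeff_lowModes]
  have h2 : (lowSymbol K k : ℂ) * lowSymbol K k = lowSymbol K k := by
    exact_mod_cast congrArg (fun r : ℝ => (r : ℂ)) (lowSymbol_mul_self K k)
  push_cast
  linear_combination (-coeff (B u u) k j) * h2

/-- Young's inequality spends half of the dissipation `2ν|Ap|²` on the force; Poincaré with smallest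
eigenvalue 1 turns the other half into enstrophy. -/
lemma inner_low_drift_le {ν K G : ℝ} (hν : 0 < ν) {g u : L2} (hg : ‖g‖ ≤ G) (hV : MemV u)
    (hA : MemDA u) :
    2 * inner ℝ (multiplier (lowSymbol K) (drift ν K g u)) (multiplier (lowSymbol K) (stokes u)) ≤
      G ^ 2 / ν - ν * enstrophy (lowSymbol K) u := by
  have h := isSymbol_lowSymbol K
  have h1 := enstrophy_le h hV hA
  rw [multiplier_low_drift, inner_sub_left, inner_smul_left, real_inner_self_eq_norm_sq]
  have h2 : inner ℝ (multiplier (lowSymbol K) g) (multiplier (lowSymbol K) (stokes u)) ≤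
      G * ‖multiplier (lowSymbol K) (stokes u)‖ :=
    (real_inner_le_norm _ _).trans (by gcongr; exact (norm_lowModes_le K g).trans hg)
  simp only [conj_trivial]
  generalize ‖multiplier (lowSymbol K) (stokes u)‖ = x at *
  have h3 : 2 * (G * x) ≤ G ^ 2 / ν + ν * x ^ 2 := by
    rw [div_add' _ _ _ hν.ne', le_div_iff₀ hν]
    nlinarith [sq_nonneg (G - ν * x)]
  nlinarith

lemma sum_norm_le_sqrt (d : Fin 2 → L2) : ∑ i, ‖d i‖ ≤ 2 * √(∑ i, ‖d i‖ ^ 2) := by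
  have h : ∀ i, ‖d i‖ ≤ √(∑ i, ‖d i‖ ^ 2) := fun i =>
    Real.le_sqrt_of_sq_le (Finset.single_le_sum (f := fun i => ‖d i‖ ^ 2)
      (fun _ _ => sq_nonneg _) (Finset.mem_univ i))
  rw [Fin.sum_univ_two]
  linarith [h 0, h 1]

lemma low_add_high (K : ℝ) (u : L2) :
    multiplier (lowSymbol K) u + multiplier (fun k => 1 - lowSymbol K k) u = u := by
  refine ext_coeff fun k j => ?_
  rw [coeff_add, coeff_multiplier (isSymbol_lowSymbol K), coeff_multiplier (isSymbol_highSymbol K)]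
  push_cast; ring

/-- The estimate of the nonlinear term in the equation for the high modes. -/
lemma abs_trilinear_high_le {K : ℝ} (hK : 0 < K) {u : L2} (hV : MemV u) (hA : MemDA u) {r : ℝ}
    (hr : enstrophy (lowSymbol K) u ≤ r ^ 2) (hr0 : 0 ≤ r) :
    |trilinear u (fun i => weakDeriv i u) (multiplier (fun k => 1 - lowSymbol K k) (stokes u))| ≤
      √(Real.log (Real.exp 1 + K)) * r * (16 * r +
        40 / K * ‖multiplier (fun k => 1 - lowSymbol K k) (stokes u)‖) *
        ‖multiplier (fun k => 1 - lowSymbol K k) (stokes u)‖ := by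
  have hl := isSymbol_lowSymbol K
  have hh := isSymbol_highSymbol K
  have hu := isRegular_of_memDA hV hA
  have hp := hu.multiplier hl
  have hq := hu.multiplier hh
  have hKq := mul_enstrophy_high_le hK hV hA
  set p := multiplier (lowSymbol K) u
  set q := multiplier (fun k => 1 - lowSymbol K k) u
  set c := multiplier (fun k => 1 - lowSymbol K k) (stokes u)
  set dp : Fin 2 → L2 := fun i => multiplier (lowSymbol K) (weakDeriv i u) with hdp
  set dq : Fin 2 → L2 := fun i => multiplier (fun k => 1 - lowSymbol K k) (weakDeriv i u) with hdq
  set L := √(Real.log (Real.exp 1 + K)) with hL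
  -- The `(q,p)` term carries no logarithm; this bound lets it share the prefactor `L r` of the
  -- other two.
  have hL1 : 1 ≤ L := by
    refine Real.one_le_sqrt.2 ?_
    rw [Real.le_log_iff_exp_le (by positivity)]
    linarith
  have hsp : √(∑ i, ‖dp i‖ ^ 2) ≤ r := Real.sqrt_le_iff.2 ⟨hr0, hr⟩
  have hsq : √(∑ i, ‖dq i‖ ^ 2) ≤ ‖c‖ / K := by
    refine Real.sqrt_le_iff.2 ⟨by positivity, ?_⟩
    rw [div_pow, le_div_iff₀ (by positivity), mul_comm]
    exact hKq
  have hMp : ∀ᵐ x ∂cellMeasure, ‖p x‖ ≤ 8 * L * r := by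
    filter_upwards [ae_norm_le_low hp.mem hp.deriv hK fun k j => by
      rw [coeff_multiplier hl, ← mul_assoc, ← Complex.ofReal_mul, lowSymbol_mul_self]] with x hx
    exact hx.trans (by gcongr)
  have hMq : ∀ᵐ x ∂cellMeasure, ‖q x‖ ≤ 12 / K * ‖c‖ := ae_norm_le_high hq.stokes hK fun k j => by
    rw [coeff_multiplier hh, ← mul_assoc, ← Complex.ofReal_mul, mul_sub, mul_one,
      lowSymbol_mul_self]
    simp
  have e : trilinear u (fun i => weakDeriv i u) c =
      trilinear p dp c + trilinear p dq c + trilinear q dp c := by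
    have e1 := trilinear_add_left hMp hMq (fun i => weakDeriv i u) c
    have e2 := trilinear_add_mid hMp dp dq c
    have e3 := trilinear_add_mid hMq dp dq c
    simp only [p, q, dp, dq, low_add_high] at e1 e2 e3
    rw [e1, e2, e3]
    -- The only term without a factor `p`, hence the only one the low-mode bound could not control.
    have e4 : trilinear q dq c = 0 := hq.trilinear_eq_zero
    simp only [q, dq] at e4
    rw [e4]
    ring
  rw [e]
  have b1 := abs_trilinear_le hMp dp c
  have b2 := abs_trilinear_le hMp dq c
  have b3 := abs_trilinear_le hMq dp c
  have s1 := (sum_norm_le_sqrt dp).trans (mul_le_mul_of_nonneg_left hsp zero_le_two)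
  have s2 := (sum_norm_le_sqrt dq).trans (mul_le_mul_of_nonneg_left hsq zero_le_two)
  have b1' : |trilinear p dp c| ≤ 8 * L * r * (2 * r) * ‖c‖ := b1.trans (by gcongr)
  have b2' : |trilinear p dq c| ≤ 8 * L * r * (2 * (‖c‖ / K)) * ‖c‖ := b2.trans (by gcongr)
  have b3' : |trilinear q dp c| ≤ 12 / K * ‖c‖ * (2 * (L * r)) * ‖c‖ := by
    refine b3.trans ?_
    gcongr
    refine s1.trans ?_
    gcongr
    exact le_mul_of_one_le_left hr0 hL1
  -- The coefficient 40 is 16 from `(p,q)` plus 24 from `(q,p)`.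
  calc _ ≤ |trilinear p dp c| + |trilinear p dq c| + |trilinear q dp c| := abs_add_three _ _ _
    _ ≤ _ := add_le_add (add_le_add b1' b2') b3'
    _ = _ := by ring

/-- `hrK` turns the nonlinear bound into `ν(2/25 · K r x + x²/5)` with `x = |Aq|`: a fraction of the
dissipation and a term linear in `x`. The weight `1 + K²` on both sides keeps the resulting bound on
`‖q‖` independent of `K`, for small `K` as well. -/
lemma inner_high_drift_le {ν K G : ℝ} (hν : 0 < ν) (hK : 0 < K) {g u : L2} (hg : ‖g‖ ≤ G)
    (hV : MemV u) (hA : MemDA u) {r : ℝ} (hr0 : 0 ≤ r) (hGr : G ≤ ν * r)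
    (hr : enstrophy (lowSymbol K) u ≤ r ^ 2)
    (hrK : 200 * (√(Real.log (Real.exp 1 + K)) * r) ≤ ν * K) :
    2 * inner ℝ (multiplier (fun k => 1 - lowSymbol K k) (drift ν K g u))
        (multiplier (fun k => 1 - lowSymbol K k) (stokes u)) ≤
      4 * ν * r ^ 2 * (1 + K ^ 2) -
        ν * (1 + K ^ 2) / 2 * enstrophy (fun k => 1 - lowSymbol K k) u := by
  have hh := isSymbol_highSymbol K
  have hu := isRegular_of_memDA hV hA
  have h1 := enstrophy_le hh hV hA
  have h2 := mul_enstrophy_high_le hK hV hA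
  have h3 := abs_trilinear_high_le hK hV hA hr hr0
  have h4 : inner ℝ (multiplier (fun k => 1 - lowSymbol K k) (B u u))
      (multiplier (fun k => 1 - lowSymbol K k) (stokes u)) =
      trilinear u (fun i => weakDeriv i u) (multiplier (fun k => 1 - lowSymbol K k) (stokes u)) := by
    have h5 : multiplier (fun k => 1 - lowSymbol K k)
        (multiplier (fun k => 1 - lowSymbol K k) (stokes u)) =
        multiplier (fun k => 1 - lowSymbol K k) (stokes u) := by
      refine ext_coeff fun k j => ?_
      have h2 : (lowSymbol K k : ℂ) * lowSymbol K k = lowSymbol K k := by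
        exact_mod_cast congrArg (fun r : ℝ => (r : ℂ)) (lowSymbol_mul_self K k)
      rw [coeff_multiplier hh, coeff_multiplier hh]
      push_cast
      linear_combination (coeff (stokes u) k j) * h2
    rw [inner_multiplier hh, h5]
    refine inner_B (ae_norm_le_stokes hu.mem hu.stokes) ?_
    refine IsMultiplier.mem_H (coeff_multiplier hh _) ?_
    exact hu.stokes.mem_H hu.mem
  rw [multiplier_high_drift, inner_sub_left, inner_sub_left, inner_smul_left,
    real_inner_self_eq_norm_sq, h4]
  have h6 : inner ℝ (multiplier (fun k => 1 - lowSymbol K k) g)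
      (multiplier (fun k => 1 - lowSymbol K k) (stokes u)) ≤
      ν * r * ‖multiplier (fun k => 1 - lowSymbol K k) (stokes u)‖ := by
    refine (real_inner_le_norm _ _).trans ?_
    gcongr
    exact ((norm_multiplier_le_self hh (abs_one_sub_lowSymbol_le K) g).trans hg).trans hGr
  have h7 := (abs_le.1 h3).1
  simp only [conj_trivial]
  generalize trilinear u (fun i => weakDeriv i u)
    (multiplier (fun k => 1 - lowSymbol K k) (stokes u)) = τ at *
  have hx : 0 ≤ ‖multiplier (fun k => 1 - lowSymbol K k) (stokes u)‖ := norm_nonneg _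
  generalize ‖multiplier (fun k => 1 - lowSymbol K k) (stokes u)‖ = x at *
  generalize enstrophy (fun k => 1 - lowSymbol K k) u = y at *
  have h8 : √(Real.log (Real.exp 1 + K)) * r * (16 * r + 40 / K * x) * x ≤
      ν * K / 200 * (16 * r + 40 / K * x) * x := by
    gcongr
    linarith
  have h9 : ν * K / 200 * (16 * r + 40 / K * x) * x = ν * (2 / 25 * (K * r * x) + x ^ 2 / 5) := by
    field_simp
    ring
  have h10 : -τ ≤ ν * (2 / 25 * (K * r * x) + x ^ 2 / 5) := by linarith
  -- The average of the two Poincaré inequalities `y ≤ x²` and `K² y ≤ x²`.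
  have h11 : (1 + K ^ 2) / 2 * y ≤ x ^ 2 := by linarith
  have h12 : 2 * (r * x) - 2 * x ^ 2 + 2 * (2 / 25 * (K * r * x) + x ^ 2 / 5) ≤
      4 * r ^ 2 * (1 + K ^ 2) - (1 + K ^ 2) / 2 * y := by
    nlinarith [sq_nonneg (x - 4 * r), sq_nonneg (x - 4 * (K * r))]
  have h13 := mul_le_mul_of_nonneg_left h12 hν.le
  linarith

/-! ### Eventual bound for a single equation -/

/-- The matrix is the identity, so the system decouples. -/
lemma velocity_symMatrix_one_zero (ν K : ℝ) (g v : Fin 2 → ℝ → L2) (i : Fin 2) (t : ℝ) :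
    velocity ν K (symMatrix 1 0) g v i t = drift ν K (g i t) (v i t) := by
  fin_cases i <;> simp [velocity, symMatrix, drift, Fin.sum_univ_two, sub_add]

lemma continuousOn_enstrophy {u : ℝ → L2} (hu : IsStrongPath u) {χ : (Fin 2 → ℤ) → ℝ}
    (hχ : IsSymbol χ) : ContinuousOn (fun t => enstrophy χ (u t)) (Set.Ici 0) :=
  continuousOn_finsetSum _ fun j _ =>
    (((multiplierL hχ).continuous.comp_continuousOn (hu.continuous_deriv j)).norm).pow 2

/-- `|B(u,u)| ≤ 24 |Au| ∑ᵢ |∂ᵢu|`, and continuity in `V` bounds the last factor on `[0, T]`. This is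
the growth condition needed for the enstrophy identity. -/
lemma exists_norm_drift_le {ν K G : ℝ} (hν : 0 < ν) {g u : ℝ → L2} (hu : IsStrongPath u)
    (hg : ∀ᵐ t ∂(volume.restrict (Set.Ioi (0 : ℝ))), ‖g t‖ ≤ G) (T : ℝ) :
    ∃ c, ∀ᵐ s ∂(volume.restrict (Set.Ioc 0 T)),
      ‖drift ν K (g s) (u s)‖ ≤ c * (1 + ‖stokes (u s)‖) := by
  have hc : ContinuousOn (fun t => ∑ i, ‖weakDeriv i (u t)‖) (Set.Icc 0 T) :=
    continuousOn_finsetSum _ fun i _ =>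
      ((hu.continuous_deriv i).mono Set.Icc_subset_Ici_self).norm
  obtain ⟨D, hD⟩ := isCompact_Icc.exists_bound_of_continuousOn hc
  refine ⟨|G| + ν + 48 * |D|, ?_⟩
  filter_upwards [ae_restrict_of_ae_restrict_of_subset Set.Ioc_subset_Ioi_self hg,
    ae_restrict_of_ae_restrict_of_subset Set.Ioc_subset_Ioi_self hu.memDA,
    ae_restrict_mem measurableSet_Ioc] with s h1 h2 h3
  have hV := hu.memV s h3.1.le
  have h4 := norm_B_le (ae_norm_le_stokes hV.1 h2.isMultiplier)
  have h5 : ∑ i, ‖weakDeriv i (u s)‖ ≤ |D| :=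
    (le_abs_self _).trans ((hD s ⟨h3.1.le, h3.2⟩).trans (le_abs_self D))
  have h6 : ‖B (u s) (u s)‖ ≤ 24 * ‖stokes (u s)‖ * |D| := h4.trans (by gcongr)
  have h7 := norm_lowModes_le K (B (u s) (u s))
  have h8 : ‖drift ν K (g s) (u s)‖ ≤ ‖g s‖ + ‖ν • stokes (u s)‖ +
      (‖B (u s) (u s)‖ + ‖lowModes K (B (u s) (u s))‖) :=
    (norm_sub_le _ _).trans (add_le_add (norm_sub_le _ _) (norm_sub_le _ _))
  rw [norm_smul, Real.norm_of_nonneg hν.le] at h8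
  have h9 := le_abs_self G
  have h10 := norm_nonneg (stokes (u s))
  have h11 := mul_nonneg (abs_nonneg G) h10
  have h12 := abs_nonneg D
  nlinarith

/-- The eventual enstrophy bound for a single equation with the low modes of the nonlinearity
removed. -/
theorem eventually_sum_norm_sq_le {ν K G r : ℝ} (hν : 0 < ν) (hK : 0 < K) (hG : 0 ≤ G)
    {g u : ℝ → L2} (hu : IsStrongPath u)
    (hg : ∀ᵐ t ∂(volume.restrict (Set.Ioi (0 : ℝ))), ‖g t‖ ≤ G)
    (hi : ∀ t, 0 ≤ t → IntervalIntegrable (fun s => drift ν K (g s) (u s)) volume 0 t)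
    (he : ∀ t, 0 ≤ t → u t = u 0 + ∫ s in (0 : ℝ)..t, drift ν K (g s) (u s))
    (hr : G < ν * r) (hrK : 200 * (√(Real.log (Real.exp 1 + K)) * r) ≤ ν * K) :
    ∀ᶠ t in atTop, ∑ j, ‖weakDeriv j (u t)‖ ^ 2 ≤ 20 * r ^ 2 := by
  have hr0 : 0 < r := by
    by_contra h
    nlinarith
  have hl := isSymbol_lowSymbol K
  have hh := isSymbol_highSymbol K
  have hb := fun T (_ : 0 < T) => exists_norm_drift_le (K := K) hν hu hg T
  have hae : ∀ {s t : ℝ}, 0 ≤ s → s ≤ t → ∀ᵐ x ∂(volume.restrict (Set.Icc s t)),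
      ‖g x‖ ≤ G ∧ MemDA (u x) ∧ x ∈ Set.Icc s t := by
    intro s t hs hst
    have h1 : volume.restrict (Set.Icc s t) ≤ volume.restrict (Set.Ici (0 : ℝ)) :=
      Measure.restrict_mono (fun x hx => hs.trans hx.1) le_rfl
    rw [← restrict_Ioi_eq_restrict_Ici] at h1
    filter_upwards [ae_mono h1 hg, ae_mono h1 hu.memDA, ae_restrict_mem measurableSet_Icc]
      with x h2 h3 h4 using ⟨h2, h3, h4⟩
  have hlow : ∀ᶠ t in atTop, enstrophy (lowSymbol K) (u t) ≤ r ^ 2 := by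
    have hc := continuousOn_enstrophy hu hl
    refine eventually_le_of_sub_le_integral (b := G ^ 2 / ν) hc hν ?_ fun s t hs hst => ?_
    · rw [div_div, ← sq, ← div_pow]
      have : G / ν < r := by rw [div_lt_iff₀ hν]; linarith
      exact pow_lt_pow_left₀ this (by positivity) two_ne_zero
    · obtain ⟨h1, h2⟩ := enstrophy_sub_eq_integral hu hi he hb hl (abs_lowSymbol_le K) hs hst
      rw [h2]
      refine intervalIntegral.integral_mono_ae_restrict hst h1 ?_ ?_
      · refine ContinuousOn.intervalIntegrable ?_
        rw [Set.uIcc_of_le hst]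
        exact continuousOn_const.sub (continuousOn_const.mul
          (hc.mono fun x hx => hs.trans hx.1))
      · filter_upwards [hae hs hst] with x ⟨h3, h4, h5⟩
        exact inner_low_drift_le hν h3 (hu.memV x (hs.trans h5.1)) h4
  -- The high-mode inequality holds only once the low modes are below `r`, so its Grönwall argument
  -- starts at `max 0 t₁`.
  obtain ⟨t₁, ht₁⟩ := eventually_atTop.1 hlow
  have hhigh : ∀ᶠ t in atTop, enstrophy (fun k => 1 - lowSymbol K k) (u t) ≤ 9 * r ^ 2 := by
    have hc : ContinuousOn (fun t => enstrophy (fun k => 1 - lowSymbol K k) (u t))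
        (Set.Ici (max 0 t₁)) :=
      (continuousOn_enstrophy hu hh).mono (Set.Ici_subset_Ici.2 (le_max_left _ _))
    -- Here `b / a = 8r²`, strictly below the claimed `9r²`.
    refine eventually_le_of_sub_le_integral (a := ν * (1 + K ^ 2) / 2)
      (b := 4 * ν * r ^ 2 * (1 + K ^ 2)) hc (by positivity) ?_ fun s t hs hst => ?_
    · rw [div_lt_iff₀ (by positivity)]
      have : 0 < ν * (1 + K ^ 2) * r ^ 2 := by positivity
      nlinarith
    · have hs0 := (le_max_left _ _).trans hs
      obtain ⟨h1, h2⟩ := enstrophy_sub_eq_integral hu hi he hb hh (abs_one_sub_lowSymbol_le K) hs0 hst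
      rw [h2]
      refine intervalIntegral.integral_mono_ae_restrict hst h1 ?_ ?_
      · refine ContinuousOn.intervalIntegrable ?_
        rw [Set.uIcc_of_le hst]
        exact continuousOn_const.sub (continuousOn_const.mul
          (hc.mono fun x hx => hs.trans hx.1))
      · filter_upwards [hae hs0 hst] with x ⟨h3, h4, h5⟩
        exact inner_high_drift_le hν hK h3 (hu.memV x (hs0.trans h5.1)) h4 hr0.le hr.le
          (ht₁ x ((le_max_right _ _).trans (hs.trans h5.1))) hrK
  filter_upwards [hlow, hhigh] with t h1 h2
  -- The triangle inequality suffices, at the cost of a factor 2: `20 = 2(1 + 9)`.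
  have h3 : ∀ f : L2, ‖f‖ ^ 2 ≤ 2 * ‖multiplier (lowSymbol K) f‖ ^ 2 +
      2 * ‖multiplier (fun k => 1 - lowSymbol K k) f‖ ^ 2 := by
    intro f
    have h4 := norm_add_le (multiplier (lowSymbol K) f) (multiplier (fun k => 1 - lowSymbol K k) f)
    rw [low_add_high] at h4
    nlinarith [norm_nonneg f, sq_nonneg (‖multiplier (lowSymbol K) f‖ -
      ‖multiplier (fun k => 1 - lowSymbol K k) f‖)]
  calc ∑ j, ‖weakDeriv j (u t)‖ ^ 2
      ≤ 2 * enstrophy (lowSymbol K) (u t) + 2 * enstrophy (fun k => 1 - lowSymbol K k) (u t) := by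
        rw [enstrophy, enstrophy, Finset.mul_sum, Finset.mul_sum, ← Finset.sum_add_distrib]
        exact Finset.sum_le_sum fun j _ => h3 _
    _ ≤ 20 * r ^ 2 := by linarith

/-! ### Conclusion for the intertwinement -/

lemma ae_norm_le_totalGrashof {ν : ℝ} (hν : 0 < ν) {g : Fin 2 → ℝ → L2}
    (hg : ∀ i, MemLinftyH (g i)) (i : Fin 2) :
    ∀ᵐ t ∂(volume.restrict (Set.Ioi (0 : ℝ))), ‖g i t‖ ≤ ν ^ 2 * totalGrashof ν g := by
  have h1 : (eLpNorm (g i) ∞ (volume.restrict (Set.Ioi 0))).toReal ≤ ν ^ 2 * totalGrashof ν g := by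
    have h2 : grashof ν (g i) ≤ totalGrashof ν g :=
      Real.le_sqrt_of_sq_le (Finset.single_le_sum (f := fun j => grashof ν (g j) ^ 2)
        (fun _ _ => sq_nonneg _) (Finset.mem_univ i))
    rw [grashof, div_le_iff₀ (by positivity)] at h2
    linarith
  have hfin := (hg i).1.eLpNorm_ne_top
  rw [eLpNorm_exponent_top] at h1 hfin
  filter_upwards [ae_le_eLpNormEssSup (f := g i) (μ := volume.restrict (Set.Ioi (0 : ℝ)))] with t ht
  refine le_trans ?_ h1
  rw [← toReal_enorm]
  exact ENNReal.toReal_mono hfin ht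

end Intertwinement

end

theorem mainTheorem6 :
    ∃ C₀ : ℝ, 0 < C₀ ∧ ∃ C₁ : ℝ, 0 < C₁ ∧
      ∀ (ν K θ₁ θ₂ : ℝ), 0 < ν → 0 < K → θ₁ + θ₂ = 1 → θ₁ = 1 →
      ∀ g v : Fin 2 → ℝ → Intertwinement.L2,
        (∀ i, Intertwinement.MemLinftyH (g i)) →
        Intertwinement.Synchronous g →
        Intertwinement.IsSolution ν K (Intertwinement.symMatrix θ₁ θ₂) g v →
        C₀ * Real.log (Real.exp 1 + K) ^ (1 / 2 : ℝ) * Intertwinement.totalGrashof ν g ≤ K →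
        Filter.limsup (fun t => ((Intertwinement.pairNormV v t : ℝ) : EReal)) Filter.atTop ≤
          ((C₁ * ν * Intertwinement.totalGrashof ν g : ℝ) : EReal) := by
  -- `400 = 2 · 200` leaves half of the smallness condition for the margin `ε`; two components give
  -- `2 · 20 r² ≤ 7² r²`.
  refine ⟨400, by norm_num, 7, by norm_num, ?_⟩
  rintro ν K θ₁ θ₂ hν hK hθ rfl g v hg - hv hC
  obtain rfl : θ₂ = 0 := by linarith
  rw [← Real.sqrt_eq_rpow] at hC
  set L := √(Real.log (Real.exp 1 + K)) with hL
  set G := Intertwinement.totalGrashof ν g with hGdef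
  have hG : 0 ≤ G := Real.sqrt_nonneg _
  have hL0 : 0 < L := by
    refine Real.sqrt_pos.2 (Real.log_pos ?_)
    linarith [Real.one_le_exp (zero_le_one' ℝ)]
  -- The single-equation bound needs `sup |g| < νr` strictly, hence `r = ν𝔤 + ε`; this also covers
  -- `𝔤 = 0`.
  have key : ∀ ε, 0 < ε → 400 * L * ε ≤ ν * K →
      limsup (fun t => ((Intertwinement.pairNormV v t : ℝ) : EReal)) atTop ≤
        ((7 * (ν * G + ε) : ℝ) : EReal) := by
    intro ε hε hεK
    have hev : ∀ i, ∀ᶠ t in atTop,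
        ∑ j, ‖Intertwinement.weakDeriv j (v i t)‖ ^ 2 ≤ 20 * (ν * G + ε) ^ 2 := by
      intro i
      have h1 := hv.integrable i
      have h2 := hv.equation i
      rw [show Intertwinement.velocity ν K (Intertwinement.symMatrix 1 0) g v i =
        fun s => Intertwinement.drift ν K (g i s) (v i s) from
          funext fun s => Intertwinement.velocity_symMatrix_one_zero ν K g v i s] at h1 h2
      refine Intertwinement.eventually_sum_norm_sq_le hν hK (by positivity) (hv.strong i)
        (Intertwinement.ae_norm_le_totalGrashof hν hg i) h1 h2 ?_ ?_
      · rw [← hGdef]; nlinarith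
      · rw [← hL]
        have h3 := mul_le_mul_of_nonneg_left hC hν.le
        nlinarith
    refine limsup_le_of_le (h := ?_)
    filter_upwards [hev 0, hev 1] with t h0 h1
    rw [EReal.coe_le_coe_iff, Intertwinement.pairNormV]
    have hr : 0 ≤ ν * G + ε := by positivity
    refine Real.sqrt_le_iff.2 ⟨by positivity, ?_⟩
    simp only [Intertwinement.normV,
      Real.sq_sqrt (Finset.sum_nonneg fun _ _ => sq_nonneg _)]
    rw [Fin.sum_univ_two]
    nlinarith [sq_nonneg (ν * G + ε)]
  have hlim : Tendsto (fun ε : ℝ => ((7 * (ν * G + ε) : ℝ) : EReal)) (𝓝[>] 0)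
      (𝓝 ((7 * ν * G : ℝ) : EReal)) := by
    have h1 : Continuous fun ε : ℝ => ((7 * (ν * G + ε) : ℝ) : EReal) :=
      continuous_coe_real_ereal.comp (by fun_prop)
    have h2 := (h1.tendsto 0).mono_left (nhdsWithin_le_nhds (s := Set.Ioi 0))
    rwa [add_zero, ← mul_assoc] at h2
  -- The left side does not depend on `ε`, so letting `ε` decrease to zero removes the margin.
  refine ge_of_tendsto hlim ?_
  have hpos : 0 < ν * K / (400 * L) := by positivity
  filter_upwards [Ioo_mem_nhdsGT hpos] with ε hε
  refine key ε hε.1 ?_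
  have := (lt_div_iff₀ (by positivity)).1 hε.2
  linarith
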